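/- Let $\sigma,\nu,\mu,r,m>0$ be constants with $\mu>r$, let $T>0$, and let $Q=\mathbb R^2\times(0,T]$ with points $(x,y,t)$. Put $$\mathcal L v=v_t-\frac{\sigma^2}{2}v_{yy}-\frac{\nu^2}{2}v_{xx}-\Big(\mu+\frac{\sigma^2}{2}\Big)v_y-(\mu-r)v,\qquad F[v]=\max\Big\{\mathcal L v+\frac{e^y}{m}\,v\,v_x,\ v-1\Big\}.$$ For $1<p<\infty$ let $W^{2,1}_{p,loc}(Q)$ be the space of (classes modulo null sets of) functions $v$ on $Q$ such that $v$ and its weak derivatives $v_t,v_x,v_y,v_{xx},v_{xy},v_{yy}$ belong to $L^p(K)$ for every compact $K\subset Q$. Derivatives below are weak derivatives, and functions in $\bigcap_{p>1}W^{2,1}_{p,loc}(Q)$ are identified with their continuous representatives on $Q$ (which exist). (Comparison principle.) Let $v_1,v_2\in L^\infty(Q)\cap\bigcap_{1<p<\infty}W^{2,1}_{p,loc}(Q)$ both satisfy the initial condition: for every $K>0$, $$\lim_{t\to0^+}\ \sup_{|y|\le K,\ x\in\mathbb R}\Big|v_i(x,y,t)-\varphi\Big(\frac{x}{\nu\sqrt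 t}\Big)\Big|=0,\qquad \varphi(x)=\int_{-\infty}^x\frac1{\sqrt{2\pi}}e^{-u^2/2}\,du .$$ Suppose that $F[v_1]\ge F[v_2]$ a.e. in $Q$ and that $\max\{\partial_x v_1,\partial_x v_2\}\ge0$ a.e. in $Q$. Then $v_1\ge v_2$ at every point of $Q$. -/

import Mathlib

open MeasureTheory Filter Set
open scoped ENNReal Topology ContDiff

noncomputable section

namespace EmissionQuota

/-- A point `(x, y, t)` of space-time `ℝ × ℝ × ℝ`. -/
abbrev Pt : Type := ℝ × ℝ × ℝ

/-- The cylinder `Q = ℝ² × (0, T]`. -/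
def cyl (T : ℝ) : Set Pt := {z | 0 < z.2.2 ∧ z.2.2 ≤ T}

/-- The interior `ℝ² × (0, T)` of `Q`, which carries the test functions. -/
def openCyl (T : ℝ) : Set Pt := {z | 0 < z.2.2 ∧ z.2.2 < T}

/-- The unit vector of the `x` direction. -/
def ex : Pt := (1, 0, 0)

/-- The unit vector of the `y` direction. -/
def ey : Pt := (0, 1, 0)

/-- The unit vector of the `t` direction. -/
def et : Pt := (0, 0, 1)

/-- `g` is a weak (distributional) derivative of `f` in the direction `e` on `ℝ² × (0, T)`:
both are locally integrable there and `∫ f ∂ₑφ = - ∫ g φ` for every test function `φ`. -/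
structure IsWeakDeriv (T : ℝ) (e : Pt) (f g : Pt → ℝ) : Prop where
  locInt_left : LocallyIntegrableOn f (openCyl T)
  locInt_right : LocallyIntegrableOn g (openCyl T)
  integral_eq : ∀ φ : Pt → ℝ, ContDiff ℝ ∞ φ → HasCompactSupport φ → tsupport φ ⊆ openCyl T →
    ∫ z, f z * fderiv ℝ φ z e = - ∫ z, g z * φ z

/-- `f` has a weak derivative in the direction `e` on `ℝ² × (0, T)`. -/
def HasWeakDeriv (T : ℝ) (e : Pt) (f : Pt → ℝ) : Prop := ∃ g, IsWeakDeriv T e f g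

open Classical in
/-- The weak derivative of `f` in the direction `e` on `ℝ² × (0, T)`. It is unique up to a null set
(`IsWeakDeriv.ae_unique`); the value is `0` where there is no weak derivative. -/
def weakDeriv (T : ℝ) (e : Pt) (f : Pt → ℝ) : Pt → ℝ :=
  if h : HasWeakDeriv T e f then Classical.choose h else 0

theorem HasWeakDeriv.isWeakDeriv {T : ℝ} {e : Pt} {f : Pt → ℝ} (h : HasWeakDeriv T e f) :
    IsWeakDeriv T e f (weakDeriv T e f) := by
  unfold weakDeriv
  rw [dif_pos h]
  exact Classical.choose_spec h

theorem isOpen_openCyl (T : ℝ) : IsOpen (openCyl T) := by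
  have h : Continuous fun z : Pt => z.2.2 := by fun_prop
  exact (isOpen_lt continuous_const h).inter (isOpen_lt h continuous_const)

theorem IsWeakDeriv.ae_unique {T : ℝ} {e : Pt} {f g h : Pt → ℝ}
    (hg : IsWeakDeriv T e f g) (hh : IsWeakDeriv T e f h) :
    ∀ᵐ z : Pt, z ∈ openCyl T → g z = h z := by
  have key := (isOpen_openCyl T).ae_eq_zero_of_integral_contDiff_smul_eq_zero
    (μ := (volume : Measure Pt)) (f := fun z => g z - h z)
    (hg.locInt_right.sub hh.locInt_right) ?_
  · filter_upwards [key] with z hz hzT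
    exact sub_eq_zero.mp (hz hzT)
  · intro φ hφ hc hs
    have aux : ∀ k : Pt → ℝ, LocallyIntegrableOn k (openCyl T) →
        Integrable (fun z => k z * φ z) := by
      intro k hk
      have hK : IntegrableOn k (tsupport φ) :=
        (hk.mono_set hs).integrableOn_isCompact hc
      have h1 : IntegrableOn (fun z => k z * φ z) (tsupport φ) :=
        hK.mul_continuousOn hφ.continuous.continuousOn hc
      refine (integrableOn_iff_integrable_of_support_subset ?_).mp h1
      intro z hz
      exact subset_tsupport φ (fun h0 => hz (by simp [h0]))
    have e1 := hg.integral_eq φ hφ hc hs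
    have e2 := hh.integral_eq φ hφ hc hs
    have e3 : (fun z => φ z • (g z - h z)) = fun z => g z * φ z - h z * φ z := by
      funext z; simp only [smul_eq_mul]; ring
    rw [e3, integral_sub (aux g hg.locInt_right) (aux h hh.locInt_right)]
    linarith

/-- `f ∈ L^p_loc(Q)`: `f` is in `L^p` of every compact subset of `Q = ℝ² × (0, T]`. -/
def MemLpLoc (T : ℝ) (p : ℝ≥0∞) (f : Pt → ℝ) : Prop :=
  ∀ K : Set Pt, K ⊆ cyl T → IsCompact K → MemLp f p (volume.restrict K)

/-- `f` has a weak derivative in the direction `e`, and that derivative is in `L^p_loc(Q)`. -/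
def WeakDerivMemLpLoc (T : ℝ) (p : ℝ≥0∞) (e : Pt) (f : Pt → ℝ) : Prop :=
  HasWeakDeriv T e f ∧ MemLpLoc T p (weakDeriv T e f)

/-- The parabolic Sobolev space `W^{2,1}_{p,loc}(Q)`: `v` and its weak derivatives
`v_t, v_x, v_y, v_xx, v_xy, v_yy` are in `L^p_loc(Q)`. -/
structure MemParabolicSobolevLoc (T : ℝ) (p : ℝ≥0∞) (v : Pt → ℝ) : Prop where
  memLpLoc : MemLpLoc T p v
  deriv_t : WeakDerivMemLpLoc T p et v
  deriv_x : WeakDerivMemLpLoc T p ex v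
  deriv_y : WeakDerivMemLpLoc T p ey v
  deriv_xx : WeakDerivMemLpLoc T p ex (weakDeriv T ex v)
  deriv_xy : WeakDerivMemLpLoc T p ey (weakDeriv T ex v)
  deriv_yy : WeakDerivMemLpLoc T p ey (weakDeriv T ey v)

/-- `v ∈ L^∞(Q) ∩ ⋂_{p > 1} W^{2,1}_{p,loc}(Q)`, with `p` finite. -/
def MemSolutionSpace (T : ℝ) (v : Pt → ℝ) : Prop :=
  MemLp v ⊤ (volume.restrict (cyl T)) ∧
    ∀ p : ℝ≥0∞, 1 < p → p < ⊤ → MemParabolicSobolevLoc T p v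

/-- The linear operator
`L v = v_t - (σ²/2) v_yy - (ν²/2) v_xx - (μ + σ²/2) v_y - (μ - r) v`. -/
def opL (T σ ν μ r : ℝ) (v : Pt → ℝ) (z : Pt) : ℝ :=
  weakDeriv T et v z - σ ^ 2 / 2 * weakDeriv T ey (weakDeriv T ey v) z
    - ν ^ 2 / 2 * weakDeriv T ex (weakDeriv T ex v) z
    - (μ + σ ^ 2 / 2) * weakDeriv T ey v z - (μ - r) * v z

/-- The operator of the variational inequality,
`F[v] = max {L v + (e^y / m) v v_x, v - 1}`. -/
def opF (T σ ν μ r m : ℝ) (v : Pt → ℝ) (z : Pt) : ℝ :=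
  max (opL T σ ν μ r v z + Real.exp z.2.1 / m * v z * weakDeriv T ex v z) (v z - 1)

/-- The distribution function of the standard Gaussian law. -/
def gaussianCdf (x : ℝ) : ℝ :=
  ∫ u in Iic x, 1 / √(2 * Real.pi) * Real.exp (-u ^ 2 / 2)

/-- The initial condition
`lim_{t → 0} sup_{|y| ≤ K, x ∈ ℝ} |v(x, y, t) - φ(x / (ν √t))| = 0` for every `K > 0`.
As `v` is determined up to a null set only, the bound is asked for almost every point; for a
continuous `v` this is the same as asking for it at every point. -/
def GaussianInitial (T ν : ℝ) (v : Pt → ℝ) : Prop :=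
  ∀ K > 0, ∀ ε > 0, ∃ δ > 0, ∀ᵐ z ∂(volume.restrict (cyl T)),
    |z.2.1| ≤ K → z.2.2 < δ → |v z - gaussianCdf (z.1 / (ν * √z.2.2))| ≤ ε

end EmissionQuota

end

open EmissionQuota

/-! Suppose `v₁ < v₂` at some point. There `v₁ - 1 < v₂ - 1 ≤ F[v₂] ≤ F[v₁]`, so the maximum
defining `F[v₁]` is attained by its differential branch, and the obstacle disappears: `L v₂ + q v₂
∂ₓv₂ ≤ L v₁ + q v₁ ∂ₓv₁` with `q = e^y / m`. One of the two slopes is nonnegative, so the nonlinear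
terms can be split with `v₂ - v₁` multiplying that slope, a term of good sign. What remains is at
most `q M |∂ₓ(v₂ - v₁)|`, where `M` bounds both functions (`sub_le_of_max_le_max`). Hence `v₂ - v₁`
is a subsolution of a linear inequality on its positivity set, with a drift that grows like `e^y`.

The barrier `ε e^{lt} (1 + x² + e^{2y} + e^{-2y})` absorbs this growth, because `2 e^y |x| ≤ e^{2y}
+ x²` (`barrier_supersolution`). Subtracting it from `v₂ - v₁` confines the positivity set to
bounded `x` and `y`, and the common initial condition keeps that set away from `t = 0`. On such a
set the drift is bounded, and an energy estimate gives the maximum principle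
(`IsParabolicJet.ae_posPart_mul_eq_zero`, `IsParabolicJet.ae_nonpos`). Then `ε → 0`.

The energy estimate tests the inequality with `U₊² χ`. The square makes the test function a `C¹`
function of `U`, so no derivative of the positive part is needed. The exponent 4 serves throughout:
it exceeds the dimension 3 of space-time, so Morrey's inequality yields continuous representatives,
and it makes products of three functions integrable on compact sets.

All approximation is by mollifiers supported at positive times. The mollified function sees only the
past, so it is defined and controlled up to and including `t = T`, although weak derivatives are
tested only in `t < T`. -/

namespace EmissionQuota

/-! ### Translations and averages in `L^p` -/

section Translation

variable {G : Type*} [NormedAddCommGroup G] [NormedSpace ℝ G] [FiniteDimensional ℝ G]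
  [MeasurableSpace G] [BorelSpace G] {μ : Measure G} [μ.IsAddHaarMeasure]

/-- Translation is continuous in `L^p` for finite `p`. -/
theorem tendsto_eLpNorm_translate_sub {p : ℝ≥0∞} (hp : 1 ≤ p) (hp' : p ≠ ⊤) {f : G → ℝ}
    (hf : MemLp f p μ) :
    Tendsto (fun s : G => eLpNorm (fun z => f (z - s) - f z) p μ) (𝓝 0) (𝓝 0) := by
  have : Fact (1 ≤ p) := ⟨hp⟩
  have : Fact (p ≠ ⊤) := ⟨hp'⟩
  have hc : Continuous fun s : G => (DomAddAct.mk (-s) +ᵥ hf.toLp f : Lp ℝ p μ) := by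
    have : Continuous fun s : G => (DomAddAct.mk (-s)) :=
      (DomAddAct.continuous_mk).comp continuous_neg
    exact this.vadd continuous_const
  have h0 : Tendsto (fun s : G => edist (DomAddAct.mk (-s) +ᵥ hf.toLp f : Lp ℝ p μ) (hf.toLp f))
      (𝓝 0) (𝓝 0) := by
    have := (hc.edist (continuous_const (y := hf.toLp f))).tendsto 0
    simpa using this
  refine h0.congr fun s => ?_
  rw [DomAddAct.mk_vadd_toLp, Lp.edist_toLp_toLp]
  refine eLpNorm_congr_ae (Eventually.of_forall fun z => ?_)
  simp [sub_eq_neg_add]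

/-- Averaging the translates of `f` moves it in `L^p` by no more than the translates do. -/
theorem eLpNorm_integral_translate_sub_le {p : ℝ≥0∞} (hp : 1 ≤ p) (hp' : p ≠ ⊤) {f : G → ℝ}
    (hf : AEStronglyMeasurable f μ) {ν : Measure G} [IsProbabilityMeasure ν] (hν : ν ≪ μ)
    (hint : ∀ z, Integrable (fun s => f (z - s)) ν) {C : ℝ≥0∞}
    (hC : ∀ᵐ s ∂ν, eLpNorm (fun z => f (z - s) - f z) p μ ≤ C) :
    eLpNorm (fun z => ∫ s, f (z - s) ∂ν - f z) p μ ≤ C := by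
  have hp0 : p ≠ 0 := (zero_lt_one.trans_le hp).ne'
  have hq : 0 < p.toReal := ENNReal.toReal_pos hp0 hp'
  have hmeas : AEStronglyMeasurable (fun w : G × G => f (w.1 - w.2) - f w.1) (μ.prod ν) := by
    refine AEStronglyMeasurable.sub ?_ hf.comp_fst
    have h1 : Measure.QuasiMeasurePreserving (fun w : G × G => w.1 - w.2) (μ.prod μ) μ :=
      quasiMeasurePreserving_sub_of_right_invariant μ μ
    exact (hf.comp_quasiMeasurePreserving h1).mono_ac
      (Measure.AbsolutelyContinuous.prod Measure.AbsolutelyContinuous.rfl hν)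
  -- Jensen's inequality for the probability measure `ν`; Tonelli then exchanges the integrals in
  -- `z` and `s`.
  have key : ∀ z, ‖∫ s, f (z - s) ∂ν - f z‖ₑ ^ p.toReal ≤
      ∫⁻ s, ‖f (z - s) - f z‖ₑ ^ p.toReal ∂ν := by
    intro z
    have e : ∫ s, f (z - s) ∂ν - f z = ∫ s, (f (z - s) - f z) ∂ν := by
      rw [integral_sub (hint z) (integrable_const _)]; simp
    have h1 : ‖∫ s, f (z - s) ∂ν - f z‖ₑ ≤ eLpNorm (fun s => f (z - s) - f z) p ν := by
      rw [e]
      refine (enorm_integral_le_lintegral_enorm _).trans ?_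
      rw [← eLpNorm_one_eq_lintegral_enorm]
      exact eLpNorm_le_eLpNorm_of_exponent_le hp
        ((hint z).sub (integrable_const _)).aestronglyMeasurable
    refine (ENNReal.rpow_le_rpow h1 hq.le).trans ?_
    rw [eLpNorm_eq_lintegral_rpow_enorm_toReal hp0 hp', ← ENNReal.rpow_mul]
    simp [hq.ne']
  rw [eLpNorm_eq_lintegral_rpow_enorm_toReal hp0 hp', one_div,
    ENNReal.rpow_inv_le_iff hq]
  calc ∫⁻ z, ‖∫ s, f (z - s) ∂ν - f z‖ₑ ^ p.toReal ∂μ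
      ≤ ∫⁻ z, ∫⁻ s, ‖f (z - s) - f z‖ₑ ^ p.toReal ∂ν ∂μ := lintegral_mono key
    _ = ∫⁻ s, ∫⁻ z, ‖f (z - s) - f z‖ₑ ^ p.toReal ∂μ ∂ν :=
        lintegral_lintegral_swap (hmeas.enorm.pow_const _)
    _ ≤ ∫⁻ _s, C ^ p.toReal ∂ν := by
        refine lintegral_mono_ae ?_
        filter_upwards [hC] with s hs
        rwa [eLpNorm_eq_lintegral_rpow_enorm_toReal hp0 hp', one_div,
          ENNReal.rpow_inv_le_iff hq] at hs
    _ = C ^ p.toReal := by simp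

end Translation

/-! ### Mollification from the past -/

instance isAddHaarMeasure_volume_plane : (volume : Measure (ℝ × ℝ)).IsAddHaarMeasure :=
  inferInstanceAs ((volume : Measure ℝ).prod (volume : Measure ℝ)).IsAddHaarMeasure

instance isAddHaarMeasure_volume_pt : (volume : Measure Pt).IsAddHaarMeasure :=
  inferInstanceAs ((volume : Measure ℝ).prod (volume : Measure (ℝ × ℝ))).IsAddHaarMeasure

noncomputable section

/-- A bump function supported at small positive times. -/
def pastBump (n : ℕ) : ContDiffBump ((0, 0, 2 / ((n : ℝ) + 1)) : Pt) where
  rIn := 1 / (2 * ((n : ℝ) + 1))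
  rOut := 1 / ((n : ℝ) + 1)
  rIn_pos := by positivity
  rIn_lt_rOut := by
    apply one_div_lt_one_div_of_lt <;> [positivity; (have : (0:ℝ) ≤ n := n.cast_nonneg; linarith)]

/-- A smooth mollifying kernel supported at small positive times. -/
def pastKernel (n : ℕ) : Pt → ℝ := (pastBump n).normed volume

/-- The mollification of `f` by `pastKernel n`, which at `z` sees `f` only at earlier times. -/
def mollify (n : ℕ) (f : Pt → ℝ) : Pt → ℝ :=
  convolution (pastKernel n) f (ContinuousLinearMap.lsmul ℝ ℝ) volume

theorem mollify_apply (n : ℕ) (f : Pt → ℝ) (z : Pt) :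
    mollify n f z = ∫ s, pastKernel n s * f (z - s) := rfl

theorem contDiff_pastKernel (n : ℕ) : ContDiff ℝ ∞ (pastKernel n) :=
  (pastBump n).contDiff_normed

theorem hasCompactSupport_pastKernel (n : ℕ) : HasCompactSupport (pastKernel n) :=
  (pastBump n).hasCompactSupport_normed

theorem mem_tsupport_pastKernel {n : ℕ} {s : Pt} (hs : s ∈ tsupport (pastKernel n)) :
    |s.1| ≤ 3 / ((n : ℝ) + 1) ∧ |s.2.1| ≤ 3 / ((n : ℝ) + 1) ∧ 0 < s.2.2 ∧
      s.2.2 ≤ 3 / ((n : ℝ) + 1) := by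
  have hpos : 0 < 1 / ((n : ℝ) + 1) := by positivity
  have h1 : s ∈ Metric.closedBall ((0, 0, 2 / ((n : ℝ) + 1)) : Pt) (1 / ((n : ℝ) + 1)) := by
    have := (pastBump n).tsupport_normed_eq (μ := (volume : Measure Pt))
    rw [pastKernel, this] at hs
    exact hs
  rw [Metric.mem_closedBall, Prod.dist_eq, Prod.dist_eq] at h1
  simp only [Real.dist_eq, sup_le_iff, sub_zero] at h1
  obtain ⟨ha, hb, hc⟩ := h1
  have e2 : 2 / ((n : ℝ) + 1) = 2 * (1 / ((n : ℝ) + 1)) := by ring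
  have e3 : 3 / ((n : ℝ) + 1) = 3 * (1 / ((n : ℝ) + 1)) := by ring
  rw [e2] at hc
  rw [e3]
  rw [abs_le] at hc
  refine ⟨by linarith, by linarith, by linarith, by linarith⟩

theorem contDiff_mollify (n : ℕ) {f : Pt → ℝ} (hf : LocallyIntegrable f) :
    ContDiff ℝ ∞ (mollify n f) :=
  (hasCompactSupport_pastKernel n).contDiff_convolution_left _ (contDiff_pastKernel n) hf

/-- Mollification converges in `L^p` for finite `p`. -/
theorem tendsto_eLpNorm_mollify_sub {p : ℝ≥0∞} (hp : 1 ≤ p) (hp' : p ≠ ⊤) {f : Pt → ℝ}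
    (hf : MemLp f p) :
    Tendsto (fun n => eLpNorm (fun z => mollify n f z - f z) p) atTop (𝓝 0) := by
  rw [ENNReal.tendsto_nhds_zero]
  intro ε hε
  have h1 := (ENNReal.tendsto_nhds_zero.1
    (tendsto_eLpNorm_translate_sub (μ := volume) hp hp' hf)) ε hε
  obtain ⟨r, hr, hball⟩ := Metric.eventually_nhds_iff.1 h1
  have h3 : Tendsto (fun n : ℕ => 3 / ((n : ℝ) + 1)) atTop (𝓝 0) :=
    tendsto_const_nhds.div_atTop (tendsto_natCast_atTop_atTop.atTop_add tendsto_const_nhds)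
  filter_upwards [h3.eventually (gt_mem_nhds hr)] with n hn
  have hcont : Continuous (pastKernel n) := (contDiff_pastKernel n).continuous
  have hnn : ∀ s, 0 ≤ pastKernel n s := (pastBump n).nonneg_normed
  have hint : Integrable (pastKernel n) :=
    hcont.integrable_of_hasCompactSupport (hasCompactSupport_pastKernel n)
  -- The kernel is the density of a probability measure, so mollifying is averaging translates.
  let ν : Measure Pt := volume.withDensity fun s => ENNReal.ofReal (pastKernel n s)
  have hm : Measurable fun s => ENNReal.ofReal (pastKernel n s) :=
    hcont.measurable.ennreal_ofReal
  have : IsProbabilityMeasure ν := by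
    constructor
    rw [withDensity_apply _ MeasurableSet.univ, Measure.restrict_univ,
      ← ofReal_integral_eq_lintegral_ofReal hint (Eventually.of_forall hnn)]
    rw [show ∫ s, pastKernel n s = 1 from (pastBump n).integral_normed, ENNReal.ofReal_one]
  have hac : ν ≪ volume := withDensity_absolutelyContinuous _ _
  have e : ∀ z, mollify n f z = ∫ s, f (z - s) ∂ν := by
    intro z
    rw [integral_withDensity_eq_integral_toReal_smul hm
      (Eventually.of_forall fun _ => ENNReal.ofReal_lt_top), mollify_apply]
    refine integral_congr_ae (Eventually.of_forall fun s => ?_)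
    simp [ENNReal.toReal_ofReal (hnn s)]
  simp only [e]
  refine eLpNorm_integral_translate_sub_le hp hp' hf.1 hac ?_ ?_
  · intro z
    rw [integrable_withDensity_iff_integrable_smul' hm
      (Eventually.of_forall fun _ => ENNReal.ofReal_lt_top)]
    have : ConvolutionExistsAt (pastKernel n) f z (ContinuousLinearMap.lsmul ℝ ℝ) volume :=
      (hasCompactSupport_pastKernel n).convolutionExists_left _ hcont
        (hf.locallyIntegrable hp) z
    refine this.congr (Eventually.of_forall fun s => ?_)
    simp [ENNReal.toReal_ofReal (hnn s)]
  · have hz : ∀ᵐ s ∂ν, pastKernel n s ≠ 0 := by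
      refine (ae_withDensity_iff hm).2 (Eventually.of_forall fun s hs h0 => hs ?_)
      simp [h0]
    filter_upwards [hz] with s hs
    refine hball ?_
    obtain ⟨h1, h2, h3, h4⟩ := mem_tsupport_pastKernel (subset_tsupport _ hs)
    rw [dist_zero_right, Prod.norm_def, Prod.norm_def]
    simp only [Real.norm_eq_abs, sup_lt_iff]
    exact ⟨by linarith, by linarith, by rw [abs_of_pos h3]; linarith⟩

end

/-! ### Boxes reaching the final time, and mollified weak derivatives -/

/-- The box `[-R, R]² × [δ, T]`. -/
def box (T R δ : ℝ) : Set Pt := Icc (-R) R ×ˢ Icc (-R) R ×ˢ Icc δ T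

theorem mem_box {T R δ : ℝ} {z : Pt} :
    z ∈ box T R δ ↔ |z.1| ≤ R ∧ |z.2.1| ≤ R ∧ δ ≤ z.2.2 ∧ z.2.2 ≤ T := by
  simp only [box, mem_prod, mem_Icc, abs_le]

theorem isCompact_box (T R δ : ℝ) : IsCompact (box T R δ) :=
  isCompact_Icc.prod (isCompact_Icc.prod isCompact_Icc)

theorem measurableSet_box (T R δ : ℝ) : MeasurableSet (box T R δ) :=
  (isCompact_box T R δ).measurableSet

theorem convex_box (T R δ : ℝ) : Convex ℝ (box T R δ) :=
  (convex_Icc _ _).prod ((convex_Icc _ _).prod (convex_Icc _ _))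

theorem box_subset_cyl {T R δ : ℝ} (hδ : 0 < δ) : box T R δ ⊆ cyl T := fun z hz => by
  obtain ⟨_, _, h3, h4⟩ := mem_box.1 hz
  exact ⟨hδ.trans_le h3, h4⟩

theorem box_subset_box {T R R' δ δ' : ℝ} (hR : R ≤ R') (hδ : δ' ≤ δ) :
    box T R δ ⊆ box T R' δ' := fun z hz => by
  obtain ⟨h1, h2, h3, h4⟩ := mem_box.1 hz
  exact mem_box.2 ⟨h1.trans hR, h2.trans hR, hδ.trans h3, h4⟩

noncomputable section

/-- The mollification of `f` restricted to a box slightly larger than `box T R δ`. -/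
def boxMollify (T R δ : ℝ) (n : ℕ) (f : Pt → ℝ) : Pt → ℝ :=
  mollify n ((box T (R + 1) (δ / 2)).indicator f)

theorem memLp_indicator_box {T R δ : ℝ} (hδ : 0 < δ) {p : ℝ≥0∞} {f : Pt → ℝ}
    (hf : MemLpLoc T p f) : MemLp ((box T (R + 1) (δ / 2)).indicator f) p :=
  (memLp_indicator_iff_restrict (measurableSet_box _ _ _)).2
    (hf _ (box_subset_cyl (half_pos hδ)) (isCompact_box _ _ _))

theorem contDiff_boxMollify {T R δ : ℝ} (hδ : 0 < δ) {f : Pt → ℝ} {p : ℝ≥0∞} (hp : 1 ≤ p)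
    (hf : MemLpLoc T p f) (n : ℕ) : ContDiff ℝ ∞ (boxMollify T R δ n f) :=
  contDiff_mollify n ((memLp_indicator_box hδ hf).locallyIntegrable hp)

theorem tendsto_boxMollify {T R δ : ℝ} (hδ : 0 < δ) {p : ℝ≥0∞} (hp : 1 ≤ p) (hp' : p ≠ ⊤)
    {f : Pt → ℝ} (hf : MemLpLoc T p f) :
    Tendsto (fun n => eLpNorm (fun z => boxMollify T R δ n f z - f z) p
      (volume.restrict (box T R δ))) atTop (𝓝 0) := by
  refine tendsto_of_tendsto_of_tendsto_of_le_of_le tendsto_const_nhds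
    (tendsto_eLpNorm_mollify_sub hp hp' (memLp_indicator_box (R := R) hδ hf))
    (fun n => zero_le) (fun n => ?_)
  refine le_trans (le_of_eq ?_) (eLpNorm_restrict_le _ p volume (box T R δ))
  refine eLpNorm_congr_ae ?_
  filter_upwards [ae_restrict_mem (measurableSet_box _ _ _)] with z hz
  rw [indicator_of_mem (box_subset_box (by linarith) (by linarith) hz)]
  rfl

/-- On the box, the derivative of the mollification is the mollification of the weak derivative. -/
theorem fderiv_boxMollify {T R δ : ℝ} (hδ : 0 < δ) {p : ℝ≥0∞} (hp : 1 ≤ p) {e : Pt}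
    {f g : Pt → ℝ} (hfg : IsWeakDeriv T e f g) (hf : MemLpLoc T p f) :
    ∀ᶠ n in atTop, ∀ z ∈ box T R δ,
      fderiv ℝ (boxMollify T R δ n f) z e = boxMollify T R δ n g z := by
  have h3 : Tendsto (fun n : ℕ => 3 / ((n : ℝ) + 1)) atTop (𝓝 0) :=
    tendsto_const_nhds.div_atTop (tendsto_natCast_atTop_atTop.atTop_add tendsto_const_nhds)
  filter_upwards [h3.eventually (gt_mem_nhds zero_lt_one),
    h3.eventually (gt_mem_nhds (half_pos hδ))] with n hn1 hn2 z hz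
  obtain ⟨z1, z2, z3, z4⟩ := mem_box.1 hz
  set K := box T (R + 1) (δ / 2) with hK
  -- Shifts in the kernel's support have strictly positive time, so `z - s` lies strictly below time
  -- `T` even when `z` is on the top face; small shifts stay in the enlarged box.
  have hmem : ∀ s ∈ tsupport (pastKernel n), z - s ∈ K ∧ z - s ∈ openCyl T := by
    intro s hs
    obtain ⟨s1, s2, s3, s4⟩ := mem_tsupport_pastKernel hs
    refine ⟨mem_box.2 ⟨?_, ?_, ?_, ?_⟩, ?_, ?_⟩
    · exact (abs_sub _ _).trans (by linarith)
    · exact (abs_sub _ _).trans (by linarith)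
    · simp only [Prod.snd_sub]; linarith
    · simp only [Prod.snd_sub]; linarith
    · simp only [Prod.snd_sub]; linarith
    · simp only [Prod.snd_sub]; linarith
  have hsmooth := contDiff_pastKernel n
  have hli := (memLp_indicator_box (R := R) hδ hf).locallyIntegrable hp
  have hd := ((hasCompactSupport_pastKernel n).hasFDerivAt_convolution_left
    (ContinuousLinearMap.lsmul ℝ ℝ) (hsmooth.of_le (by simp)) hli z).fderiv
  have hint : Integrable (fun s => (ContinuousLinearMap.precompL Pt
      (ContinuousLinearMap.lsmul ℝ ℝ)) (fderiv ℝ (pastKernel n) s) (K.indicator f (z - s))) :=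
    ((hasCompactSupport_pastKernel n).fderiv ℝ).convolutionExists_left _
      (hsmooth.continuous_fderiv (by simp)) hli z
  -- The kernel reflected about `z` is an admissible test function; its derivative changes sign,
  -- which cancels the sign of the weak derivative.
  let φ : Pt → ℝ := fun w => pastKernel n (z - w)
  have hφ : ContDiff ℝ ∞ φ := hsmooth.comp (contDiff_const.sub contDiff_id)
  have hφs : ∀ w ∈ tsupport φ, z - w ∈ tsupport (pastKernel n) := by
    intro w hw
    exact (tsupport_comp_subset_preimage (pastKernel n)
      (f := fun w : Pt => z - w) (by fun_prop)) hw
  have hφc : HasCompactSupport φ :=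
    (hasCompactSupport_pastKernel n).comp_homeomorph (Homeomorph.subLeft z)
  have hφT : tsupport φ ⊆ openCyl T := fun w hw => by
    simpa using (hmem _ (hφs w hw)).2
  have hφ' : ∀ w, fderiv ℝ φ w e = - fderiv ℝ (pastKernel n) (z - w) e := by
    intro w
    have h1 : HasFDerivAt (fun w : Pt => z - w) (-ContinuousLinearMap.id ℝ Pt) w := by
      simpa using (hasFDerivAt_id w).const_sub z
    have h2 := ((hsmooth.differentiable (by simp) (z - w)).hasFDerivAt.comp w h1).fderiv
    change fderiv ℝ φ w = _ at h2
    rw [h2]; simp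
  have ibp := hfg.integral_eq φ hφ hφc hφT
  calc fderiv ℝ (boxMollify T R δ n f) z e
      = ∫ s, fderiv ℝ (pastKernel n) s e * K.indicator f (z - s) := by
        have : fderiv ℝ (boxMollify T R δ n f) z = _ := hd
        rw [this, convolution, ContinuousLinearMap.integral_apply hint]
        rfl
    _ = ∫ w, fderiv ℝ (pastKernel n) (z - w) e * K.indicator f w := by
        rw [← integral_sub_left_eq_self _ volume z]
        simp
    _ = - ∫ w, f w * fderiv ℝ φ w e := by
        rw [← integral_neg]
        refine integral_congr_ae (Eventually.of_forall fun w => ?_)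
        simp only [hφ']
        by_cases hw : z - w ∈ tsupport (pastKernel n)
        · have hwK : w ∈ K := by simpa using (hmem _ hw).1
          rw [indicator_of_mem hwK]; ring
        · have : fderiv ℝ (pastKernel n) (z - w) = 0 :=
            image_eq_zero_of_notMem_tsupport fun h => hw (tsupport_fderiv_subset ℝ h)
          simp [this]
    _ = ∫ w, pastKernel n (z - w) * K.indicator g w := by
        rw [ibp, neg_neg]
        refine integral_congr_ae (Eventually.of_forall fun w => ?_)
        simp only [φ]
        by_cases hw : z - w ∈ tsupport (pastKernel n)
        · have hwK : w ∈ K := by simpa using (hmem _ hw).1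
          rw [indicator_of_mem hwK]; ring
        · simp [image_eq_zero_of_notMem_tsupport hw]
    _ = boxMollify T R δ n g z := by
        rw [boxMollify, mollify_apply, ← integral_sub_left_eq_self _ volume z]
        simp [hK]

theorem tendsto_fderiv_boxMollify {T R δ : ℝ} (hδ : 0 < δ) {p : ℝ≥0∞} (hp : 1 ≤ p)
    (hp' : p ≠ ⊤) {e : Pt} {f g : Pt → ℝ} (hfg : IsWeakDeriv T e f g) (hf : MemLpLoc T p f)
    (hg : MemLpLoc T p g) :
    Tendsto (fun n => eLpNorm (fun z => fderiv ℝ (boxMollify T R δ n f) z e - g z) p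
      (volume.restrict (box T R δ))) atTop (𝓝 0) := by
  refine (tendsto_boxMollify (R := R) hδ hp hp' hg).congr' ?_
  filter_upwards [fderiv_boxMollify (R := R) hδ hp hfg hf] with n hn
  refine eLpNorm_congr_ae ?_
  filter_upwards [ae_restrict_mem (measurableSet_box _ _ _)] with z hz
  rw [hn z hz]

end

/-! ### Morrey's inequality on a compact convex set -/

section Morrey

variable {G : Type*} [NormedAddCommGroup G] [NormedSpace ℝ G] [FiniteDimensional ℝ G]
  [MeasurableSpace G] [BorelSpace G] {μ : Measure G} [μ.IsAddHaarMeasure]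

theorem lintegral_comp_homothety (z : G) {s : ℝ} (hs : 0 < s) {k : G → ℝ≥0∞}
    (hk : Measurable k) :
    ∫⁻ w, k (z + s • (w - z)) ∂μ =
      ENNReal.ofReal (s ^ Module.finrank ℝ G)⁻¹ * ∫⁻ w, k w ∂μ := by
  have h1 : ∫⁻ w, k (z + s • (w - z)) ∂μ = ∫⁻ w, k (z + s • w) ∂μ := by
    simp only [sub_eq_add_neg]
    exact lintegral_add_right_eq_self (μ := μ) (fun w => k (z + s • w)) (-z)
  have h2 : ∫⁻ w, k (z + s • w) ∂μ = ∫⁻ w, k (z + w) ∂(Measure.map (s • ·) μ) :=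
    (lintegral_map (f := fun w => k (z + w)) (hk.comp (measurable_const_add z))
      (measurable_const_smul s)).symm
  rw [h1, h2, Measure.map_addHaar_smul μ hs.ne', lintegral_smul_measure,
    lintegral_add_left_eq_self (μ := μ) k z, abs_of_pos (by positivity), smul_eq_mul]

/-- Hölder reduces the integral to an `L^p` norm. By convexity the contraction towards `z` maps `B`
into itself, and its Jacobian costs the factor `s^{-d}`, hence `s^{-d/p}` after taking the `p`-th
root. -/
theorem setLIntegral_enorm_comp_homothety_le {F : Type*} [NormedAddCommGroup F] {p : ℝ}
    (hp : 1 ≤ p) {B : Set G} (hB : Convex ℝ B) (hBm : MeasurableSet B) {z : G} (hz : z ∈ B)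
    {s : ℝ} (hs : 0 < s) (hs1 : s ≤ 1) {h : G → F} (hh : Continuous h) :
    ∫⁻ w in B, ‖h (z + s • (w - z))‖ₑ ∂μ ≤
      ENNReal.ofReal (s ^ (-(Module.finrank ℝ G / p : ℝ))) *
        eLpNorm h (ENNReal.ofReal p) (μ.restrict B) * μ B ^ (1 - 1 / p) := by
  have hp0 : 0 < p := by linarith
  have hP0 : ENNReal.ofReal p ≠ 0 := by simpa using hp0
  have hPt : (ENNReal.ofReal p).toReal = p := ENNReal.toReal_ofReal hp0.le
  have hl := eLpNorm_le_eLpNorm_mul_rpow_measure_univ (μ := μ.restrict B)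
    (f := fun w => h (z + s • (w - z))) (p := 1) (q := ENNReal.ofReal p)
    (by simpa using hp) (hh.stronglyMeasurable.comp_measurable (by fun_prop)).aestronglyMeasurable
  rw [eLpNorm_one_eq_lintegral_enorm, Measure.restrict_apply_univ, hPt] at hl
  simp only [ENNReal.toReal_one, div_one] at hl
  refine hl.trans ?_
  gcongr
  rw [eLpNorm_eq_lintegral_rpow_enorm_toReal hP0 ENNReal.ofReal_ne_top,
    eLpNorm_eq_lintegral_rpow_enorm_toReal hP0 ENNReal.ofReal_ne_top, hPt]
  set k : G → ℝ≥0∞ := B.indicator fun w => ‖h w‖ₑ ^ p with hk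
  have hkm : Measurable k := (hh.enorm.measurable.pow_const p).indicator hBm
  have h1 : ∫⁻ w in B, ‖h (z + s • (w - z))‖ₑ ^ p ∂μ ≤
      ENNReal.ofReal (s ^ Module.finrank ℝ G)⁻¹ * ∫⁻ w in B, ‖h w‖ₑ ^ p ∂μ := by
    have hki : ∫⁻ w in B, ‖h w‖ₑ ^ p ∂μ = ∫⁻ w, k w ∂μ := (lintegral_indicator hBm _).symm
    rw [hki, ← lintegral_comp_homothety z hs hkm]
    refine (setLIntegral_mono_ae' hBm (Eventually.of_forall fun w hw => ?_)).trans
      (setLIntegral_le_lintegral B _)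
    have hmem : z + s • (w - z) ∈ B := hB.add_smul_sub_mem hz hw ⟨hs.le, hs1⟩
    rw [hk, indicator_of_mem hmem]
  refine (ENNReal.rpow_le_rpow h1 (by positivity)).trans (le_of_eq ?_)
  rw [ENNReal.mul_rpow_of_nonneg _ _ (by positivity), ENNReal.ofReal_rpow_of_nonneg
    (by positivity) (by positivity)]
  congr 2
  rw [← Real.rpow_natCast, ← Real.rpow_neg hs.le, ← Real.rpow_mul hs.le]
  congr 1
  ring

/-- Morrey's inequality on a bounded convex set, for functions smooth up to the boundary. -/
theorem exists_morrey_const {p : ℝ} (hp : 1 ≤ p) (hd : (Module.finrank ℝ G : ℝ) < p) {B : Set G}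
    (hB : Convex ℝ B) (hBc : IsCompact B) :
    ∃ C : ℝ≥0∞, C ≠ ⊤ ∧ ∀ F : G → ℝ, ContDiff ℝ 1 F → ∀ z ∈ B,
      ‖F z‖ₑ * μ B ≤ C * (eLpNorm F (ENNReal.ofReal p) (μ.restrict B) +
        eLpNorm (fderiv ℝ F) (ENNReal.ofReal p) (μ.restrict B)) := by
  have hBm := hBc.measurableSet
  have hp0 : 0 < p := by linarith
  set a : ℝ := -(Module.finrank ℝ G / p : ℝ)
  set D : ℝ := Metric.diam B
  set V : ℝ≥0∞ := μ B ^ (1 - 1 / p)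
  set I : ℝ≥0∞ := ∫⁻ s in Ioc (0 : ℝ) 1, ENNReal.ofReal (s ^ a)
  have hV : V ≠ ⊤ := ENNReal.rpow_ne_top_of_nonneg
    (by rw [sub_nonneg]; exact (div_le_one hp0).2 hp) hBc.measure_lt_top.ne
  -- The only use of `d < p`: the power `s^{-d/p}` is integrable at `0`.
  have hI : I ≠ ⊤ := by
    have h1 : -1 < a := by
      have : (Module.finrank ℝ G / p : ℝ) < 1 := (div_lt_one hp0).2 hd
      simp only [a]; linarith
    have h2 := (intervalIntegral.intervalIntegrable_rpow' (a := 0) (b := 1) h1).1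
    exact (h2.lintegral_lt_top).ne
  refine ⟨V + ENNReal.ofReal D * I * V, by finiteness, fun F hF z hz => ?_⟩
  set E := eLpNorm (fderiv ℝ F) (ENNReal.ofReal p) (μ.restrict B)
  have hF' : Continuous (fderiv ℝ F) := hF.continuous_fderiv (by simp)
  -- The fundamental theorem of calculus along the segment from `z` to `w`, to be averaged over `w ∈
  -- B`.
  have seg : ∀ w ∈ B, ‖F w - F z‖ₑ ≤
      ∫⁻ s in Ioc (0 : ℝ) 1, ENNReal.ofReal D * ‖fderiv ℝ F (z + s • (w - z))‖ₑ := by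
    intro w hw
    have hγ : ∀ s : ℝ, HasDerivAt (fun s : ℝ => F (z + s • (w - z)))
        (fderiv ℝ F (z + s • (w - z)) (w - z)) s := by
      intro s
      have h1 : HasDerivAt (fun s : ℝ => z + s • (w - z)) (w - z) s := by
        simpa using ((hasDerivAt_id s).smul_const (w - z)).const_add z
      exact ((hF.differentiable (by simp) _).hasFDerivAt).comp_hasDerivAt s h1
    have h2 := enorm_sub_le_lintegral_deriv_of_contDiffOn_Icc
      (f := fun s : ℝ => F (z + s • (w - z))) (a := 0) (b := 1)
      (hF.comp (by fun_prop)).contDiffOn zero_le_one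
    simp only [one_smul, zero_smul, add_zero, add_sub_cancel] at h2
    refine h2.trans ?_
    rw [restrict_Ioc_eq_restrict_Icc]
    refine lintegral_mono fun s => ?_
    rw [(hγ s).deriv, mul_comm]
    refine (ContinuousLinearMap.le_opENorm _ _).trans ?_
    gcongr
    rw [← ofReal_norm, ← dist_eq_norm]
    exact ENNReal.ofReal_le_ofReal (Metric.dist_le_diam_of_mem hBc.isBounded hw hz)
  have havg : ∫⁻ w in B, ‖F w - F z‖ₑ ∂μ ≤ ENNReal.ofReal D * I * V * E := by
    calc ∫⁻ w in B, ‖F w - F z‖ₑ ∂μ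
        ≤ ∫⁻ w in B, (∫⁻ s in Ioc (0 : ℝ) 1,
            ENNReal.ofReal D * ‖fderiv ℝ F (z + s • (w - z))‖ₑ) ∂μ :=
          setLIntegral_mono_ae' hBm (Eventually.of_forall seg)
      _ = ∫⁻ s in Ioc (0 : ℝ) 1, ∫⁻ w in B,
            ENNReal.ofReal D * ‖fderiv ℝ F (z + s • (w - z))‖ₑ ∂μ := by
          refine lintegral_lintegral_swap (Measurable.aemeasurable ?_)
          have : Continuous fun q : G × ℝ => ‖fderiv ℝ F (z + q.2 • (q.1 - z))‖ₑ :=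
            (hF'.comp (by fun_prop)).enorm
          exact measurable_const.mul this.measurable
      _ ≤ ∫⁻ s in Ioc (0 : ℝ) 1, ENNReal.ofReal (s ^ a) * (ENNReal.ofReal D * V * E) := by
          refine setLIntegral_mono_ae' measurableSet_Ioc (Eventually.of_forall fun s hs => ?_)
          rw [lintegral_const_mul' _ _ ENNReal.ofReal_ne_top]
          calc _ ≤ ENNReal.ofReal D * (ENNReal.ofReal (s ^ a) * E * V) := by
                gcongr
                exact setLIntegral_enorm_comp_homothety_le hp hB hBm hz hs.1 hs.2 hF'
            _ = _ := by ring
      _ = ENNReal.ofReal D * I * V * E := by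
          rw [lintegral_mul_const _ (by fun_prop)]; ring
  have hF1 : ∫⁻ w in B, ‖F w‖ₑ ∂μ ≤ eLpNorm F (ENNReal.ofReal p) (μ.restrict B) * V := by
    have := eLpNorm_le_eLpNorm_mul_rpow_measure_univ (μ := μ.restrict B)
      (f := F) (p := 1) (q := ENNReal.ofReal p) (by simpa using hp)
      hF.continuous.aestronglyMeasurable
    rw [eLpNorm_one_eq_lintegral_enorm, Measure.restrict_apply_univ,
      ENNReal.toReal_ofReal hp0.le] at this
    simpa only [ENNReal.toReal_one, div_one] using this
  calc ‖F z‖ₑ * μ B = ∫⁻ _w in B, ‖F z‖ₑ ∂μ := by simp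
    _ ≤ ∫⁻ w in B, (‖F w‖ₑ + ‖F w - F z‖ₑ) ∂μ := by
        refine lintegral_mono fun w => ?_
        have : F z = F w - (F w - F z) := by ring
        conv_lhs => rw [this]
        exact enorm_sub_le
    _ = ∫⁻ w in B, ‖F w‖ₑ ∂μ + ∫⁻ w in B, ‖F w - F z‖ₑ ∂μ :=
        lintegral_add_left hF.continuous.enorm.measurable _
    _ ≤ eLpNorm F (ENNReal.ofReal p) (μ.restrict B) * V + ENNReal.ofReal D * I * V * E :=
        add_le_add hF1 havg
    _ ≤ _ := by
        rw [mul_add]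
        gcongr ?_ + ?_
        · rw [mul_comm]; gcongr; exact le_self_add
        · gcongr; exact le_add_self

end Morrey

/-! ### Continuous representatives -/

/-- Morrey's inequality involves the full differential; this reduces it to the three coordinate
derivatives, the only ones known weakly. -/
theorem enorm_dual_le (L : Pt →L[ℝ] ℝ) : ‖L‖ₑ ≤ ‖L ex‖ₑ + ‖L ey‖ₑ + ‖L et‖ₑ := by
  have h : ‖L‖ ≤ ‖L ex‖ + ‖L ey‖ + ‖L et‖ := by
    refine L.opNorm_le_bound (by positivity) fun z => ?_
    have e : z = z.1 • ex + z.2.1 • ey + z.2.2 • et := by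
      simp [ex, ey, et]
    have h1 : |z.1| ≤ ‖z‖ := norm_fst_le z
    have h2 : |z.2.1| ≤ ‖z‖ := (norm_fst_le z.2).trans (norm_snd_le z)
    have h3 : |z.2.2| ≤ ‖z‖ := (norm_snd_le z.2).trans (norm_snd_le z)
    calc ‖L z‖ = ‖z.1 • L ex + z.2.1 • L ey + z.2.2 • L et‖ := by
          conv_lhs => rw [e]
          simp only [map_add, map_smul]
      _ ≤ |z.1| * ‖L ex‖ + |z.2.1| * ‖L ey‖ + |z.2.2| * ‖L et‖ := by
          refine norm_add₃_le.trans (le_of_eq ?_)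
          simp only [norm_smul, Real.norm_eq_abs]
      _ ≤ ‖z‖ * ‖L ex‖ + ‖z‖ * ‖L ey‖ + ‖z‖ * ‖L et‖ := by gcongr
      _ = _ := by ring
  rw [← ofReal_norm, ← ofReal_norm, ← ofReal_norm, ← ofReal_norm,
    ← ENNReal.ofReal_add (by positivity) (by positivity),
    ← ENNReal.ofReal_add (by positivity) (by positivity)]
  exact ENNReal.ofReal_le_ofReal h

theorem interior_box_nonempty {T R δ : ℝ} (hR : 0 < R) (hδT : δ < T) :
    (interior (box T R δ)).Nonempty := by
  rw [box, interior_prod_eq, interior_prod_eq, interior_Icc, interior_Icc]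
  exact ⟨(0, 0, (δ + T) / 2), by simp [hR], by simp [hR], by constructor <;> simp <;> linarith⟩

theorem volume_box_pos {T R δ : ℝ} (hR : 0 < R) (hδT : δ < T) : 0 < volume (box T R δ) :=
  Measure.measure_pos_of_nonempty_interior _ (interior_box_nonempty hR hδT)

theorem box_subset_closure_interior {T R δ : ℝ} (hR : 0 < R) (hδT : δ < T) :
    box T R δ ⊆ closure (interior (box T R δ)) := by
  rw [(convex_box T R δ).closure_interior_eq_closure_of_nonempty_interior
    (interior_box_nonempty hR hδT)]
  exact subset_closure

theorem eLpNorm_sub_le_of_common {α E : Type*} [MeasurableSpace α] [NormedAddCommGroup E]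
    {μ : Measure α} {p : ℝ≥0∞} (hp : 1 ≤ p) {f g h : α → E}
    (hf : AEStronglyMeasurable f μ) (hg : AEStronglyMeasurable g μ)
    (hh : AEStronglyMeasurable h μ) :
    eLpNorm (fun z => f z - g z) p μ ≤
      eLpNorm (fun z => f z - h z) p μ + eLpNorm (fun z => g z - h z) p μ := by
  have e : (fun z => f z - g z) = (fun z => f z - h z) - fun z => g z - h z := by
    funext z; simp
  rw [e]
  exact eLpNorm_sub_le (hf.sub hh) (hg.sub hh) hp

/-- The mollifications converge in `L^4` together with their first derivatives. Since `4 > 3`,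
Morrey's inequality turns this into uniform convergence on the box, so the limit is continuous. -/
theorem exists_continuousOn_box {T R δ : ℝ} (hR : 0 < R) (hδ : 0 < δ) (hδT : δ < T)
    {v gx gy gt : Pt → ℝ} (hx : IsWeakDeriv T ex v gx) (hy : IsWeakDeriv T ey v gy)
    (ht : IsWeakDeriv T et v gt) (hv : MemLpLoc T 4 v) (hgx : MemLpLoc T 4 gx)
    (hgy : MemLpLoc T 4 gy) (hgt : MemLpLoc T 4 gt) :
    ∃ w : Pt → ℝ, ContinuousOn w (box T R δ) ∧ v =ᵐ[volume.restrict (box T R δ)] w := by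
  set B := box T R δ with hB
  set κ : Measure Pt := volume.restrict B
  have h14 : (1 : ℝ≥0∞) ≤ 4 := by norm_num
  have h4t : (4 : ℝ≥0∞) ≠ ⊤ := by norm_num
  have h4 : ENNReal.ofReal 4 = 4 := by simp
  set F : ℕ → Pt → ℝ := fun n => boxMollify T R δ n v
  have hF : ∀ n, ContDiff ℝ ∞ (F n) := contDiff_boxMollify hδ h14 hv
  have hF' : ∀ n e, Continuous fun z => fderiv ℝ (F n) z e := fun n e =>
    ((hF n).continuous_fderiv (by simp)).clm_apply continuous_const
  have hmeas : ∀ f, MemLpLoc T 4 f → AEStronglyMeasurable f κ := fun f hf =>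
    (hf B (box_subset_cyl hδ) (isCompact_box _ _ _)).1
  set a : ℕ → ℝ≥0∞ := fun n => eLpNorm (fun z => F n z - v z) 4 κ +
    (eLpNorm (fun z => fderiv ℝ (F n) z ex - gx z) 4 κ +
      eLpNorm (fun z => fderiv ℝ (F n) z ey - gy z) 4 κ +
      eLpNorm (fun z => fderiv ℝ (F n) z et - gt z) 4 κ)
  have hFv := tendsto_boxMollify (R := R) hδ h14 h4t hv
  have ha : Tendsto a atTop (𝓝 0) := by
    simpa using hFv.add (((tendsto_fderiv_boxMollify (R := R) hδ h14 h4t hx hv hgx).add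
      (tendsto_fderiv_boxMollify (R := R) hδ h14 h4t hy hv hgy)).add
      (tendsto_fderiv_boxMollify (R := R) hδ h14 h4t ht hv hgt))
  obtain ⟨C, hC, hM⟩ := exists_morrey_const (μ := (volume : Measure Pt)) (p := 4) (by norm_num)
    (by norm_num [Module.finrank_prod]) (convex_box T R δ) (isCompact_box T R δ)
  have hB0 : volume B ≠ 0 := (volume_box_pos hR hδT).ne'
  have hBt : volume B ≠ ⊤ := (isCompact_box T R δ).measure_lt_top.ne
  set b : ℕ → ℝ≥0∞ := fun n => C * a n / volume B
  have hb : Tendsto b atTop (𝓝 0) := by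
    have := ENNReal.Tendsto.div_const (ENNReal.Tendsto.const_mul ha (Or.inr hC))
      (b := volume B) (Or.inr hB0)
    simpa using this
  have hest : ∀ n m, ∀ z ∈ B, ‖F n z - F m z‖ₑ ≤ b n + b m := by
    intro n m z hz
    have h1 := hM (fun z => F n z - F m z) (((hF n).sub (hF m)).of_le (by simp)) z hz
    rw [h4] at h1
    have hd : ∀ z, fderiv ℝ (fun z => F n z - F m z) z = fderiv ℝ (F n) z - fderiv ℝ (F m) z :=
      fun z => fderiv_fun_sub ((hF n).differentiable (by simp) z)
        ((hF m).differentiable (by simp) z)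
    have h2 : eLpNorm (fderiv ℝ fun z => F n z - F m z) 4 κ ≤
        eLpNorm (fun z => fderiv ℝ (F n) z ex - fderiv ℝ (F m) z ex) 4 κ +
        eLpNorm (fun z => fderiv ℝ (F n) z ey - fderiv ℝ (F m) z ey) 4 κ +
        eLpNorm (fun z => fderiv ℝ (F n) z et - fderiv ℝ (F m) z et) 4 κ := by
      have hmm : ∀ e, AEStronglyMeasurable
          (fun z => ‖fderiv ℝ (F n) z e - fderiv ℝ (F m) z e‖) κ := fun e =>
        ((hF' n e).sub (hF' m e)).norm.aestronglyMeasurable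
      calc eLpNorm (fderiv ℝ fun z => F n z - F m z) 4 κ
          ≤ eLpNorm ((fun z => ‖fderiv ℝ (F n) z ex - fderiv ℝ (F m) z ex‖) +
              (fun z => ‖fderiv ℝ (F n) z ey - fderiv ℝ (F m) z ey‖) +
              fun z => ‖fderiv ℝ (F n) z et - fderiv ℝ (F m) z et‖) 4 κ := by
            refine eLpNorm_mono_enorm fun z => ?_
            rw [hd z]
            refine (enorm_dual_le _).trans (le_of_eq ?_)
            simp only [sub_apply, Pi.add_apply]
            rw [← ofReal_norm (‖_‖ + ‖_‖ + ‖_‖), Real.norm_of_nonneg (by positivity),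
              ENNReal.ofReal_add (by positivity) (by positivity), ENNReal.ofReal_add (by positivity) (by positivity)]
            simp only [ofReal_norm]
        _ ≤ _ := by
            refine (eLpNorm_add_le ((hmm _).add (hmm _)) (hmm _) h14).trans ?_
            rw [eLpNorm_norm]
            gcongr
            refine (eLpNorm_add_le (hmm _) (hmm _) h14).trans ?_
            rw [eLpNorm_norm, eLpNorm_norm]
    have h3 : eLpNorm (fun z => F n z - F m z) 4 κ +
        eLpNorm (fderiv ℝ fun z => F n z - F m z) 4 κ ≤ a n + a m := by
      have c0 := eLpNorm_sub_le_of_common (μ := κ) h14 (hF n).continuous.aestronglyMeasurable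
        (hF m).continuous.aestronglyMeasurable (hmeas v hv)
      have c1 := fun e g hg => eLpNorm_sub_le_of_common (μ := κ) h14
        (hF' n e).aestronglyMeasurable (hF' m e).aestronglyMeasurable (hmeas g hg)
      calc _ ≤ _ := add_le_add c0 (h2.trans (add_le_add (add_le_add (c1 ex gx hgx)
            (c1 ey gy hgy)) (c1 et gt hgt)))
        _ = a n + a m := by simp only [a]; ring
    have h4' : b n + b m = C * (a n + a m) / volume B := by
      rw [mul_add, ENNReal.add_div]
    rw [h4', ENNReal.le_div_iff_mul_le (Or.inl hB0) (Or.inl hBt)]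
    exact h1.trans (by gcongr)
  have hcau : UniformCauchySeqOn F atTop B := by
    rw [Metric.uniformCauchySeqOn_iff]
    intro ε hε
    obtain ⟨N, hN⟩ := eventually_atTop.1
      (hb.eventually (gt_mem_nhds (ENNReal.ofReal_pos.2 (half_pos hε))))
    refine ⟨N, fun n hn m hm z hz => ?_⟩
    have h1 := (hest n m z hz).trans_lt (ENNReal.add_lt_add (hN n hn) (hN m hm))
    rw [← ENNReal.ofReal_add (half_pos hε).le (half_pos hε).le, add_halves, ← ofReal_norm,
      ENNReal.ofReal_lt_ofReal_iff hε] at h1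
    rwa [dist_eq_norm]
  have hlim : ∀ z ∈ B, Tendsto (fun n => F n z) atTop (𝓝 (limUnder atTop fun n => F n z)) :=
    fun z hz => (hcau.cauchySeq hz).tendsto_limUnder
  refine ⟨fun z => limUnder atTop fun n => F n z, ?_, ?_⟩
  · exact (hcau.tendstoUniformlyOn_of_tendsto hlim).continuousOn
      (Frequently.of_forall fun n => (hF n).continuous.continuousOn)
  -- Convergence in `L^4` gives a subsequence converging a.e. to `v`, which identifies the uniform
  -- limit with `v`.
  · have hTM : TendstoInMeasure κ F atTop v :=
      tendstoInMeasure_of_tendsto_eLpNorm (by norm_num)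
        (fun n => (hF n).continuous.aestronglyMeasurable) (hmeas v hv) hFv
    obtain ⟨ns, hns, hae⟩ := hTM.exists_seq_tendsto_ae
    filter_upwards [hae, ae_restrict_mem (measurableSet_box T R δ)] with z hz hzB
    exact tendsto_nhds_unique hz ((hlim z hzB).comp hns.tendsto_atTop)

/-- Functions with weak first derivatives in `L^4_loc(Q)` have a continuous representative
on `Q = ℝ² × (0, T]`. -/
theorem exists_continuousOn_cyl {T : ℝ} (hT : 0 < T)
    {v gx gy gt : Pt → ℝ} (hx : IsWeakDeriv T ex v gx) (hy : IsWeakDeriv T ey v gy)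
    (ht : IsWeakDeriv T et v gt) (hv : MemLpLoc T 4 v) (hgx : MemLpLoc T 4 gx)
    (hgy : MemLpLoc T 4 gy) (hgt : MemLpLoc T 4 gt) :
    ∃ w : Pt → ℝ, ContinuousOn w (cyl T) ∧ v =ᵐ[volume.restrict (cyl T)] w := by
  have hR : ∀ n : ℕ, (0 : ℝ) < n + 1 := fun n => by positivity
  -- The shift by 2 keeps the lower time below `T` already for `n = 0`, so every box has nonempty
  -- interior.
  have hδ : ∀ n : ℕ, 0 < T / ((n : ℝ) + 2) := fun n => by positivity
  have hδT : ∀ n : ℕ, T / ((n : ℝ) + 2) < T := fun n =>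
    div_lt_self hT (by have : (0 : ℝ) ≤ n := n.cast_nonneg; linarith)
  set B : ℕ → Set Pt := fun n => box T (n + 1) (T / ((n : ℝ) + 2))
  have hmono : ∀ {n m : ℕ}, n ≤ m → B n ⊆ B m := fun {n m} h => by
    have h' : (n : ℝ) ≤ m := by exact_mod_cast h
    exact box_subset_box (by linarith) (by gcongr)
  choose W hWc hWe using fun n : ℕ => exists_continuousOn_box (hR n) (hδ n) (hδT n)
    hx hy ht hv hgx hgy hgt
  -- Two continuous functions that agree a.e. on a set contained in the closure of its interior
  -- agree everywhere on it, so the local representatives glue.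
  have hagree : ∀ {n m : ℕ}, n ≤ m → EqOn (W n) (W m) (B n) := fun {n m} h => by
    refine Measure.eqOn_of_ae_eq (μ := (volume : Measure Pt)) ?_ (hWc n)
      ((hWc m).mono (hmono h)) (box_subset_closure_interior (hR n) (hδT n))
    filter_upwards [hWe n, ae_restrict_of_ae_restrict_of_subset (hmono h) (hWe m)] with z h1 h2
    rw [← h1, ← h2]
  have hlarge : ∀ z ∈ cyl T, ∃ n : ℕ, |z.1| < n + 1 ∧ |z.2.1| < n + 1 ∧
      T / ((n : ℝ) + 2) < z.2.2 := by
    intro z hz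
    obtain ⟨n, hn⟩ := exists_nat_gt (max (max |z.1| |z.2.1|) (T / z.2.2))
    simp only [max_lt_iff] at hn
    refine ⟨n, by linarith [hn.1.1], by linarith [hn.1.2], ?_⟩
    have h2 := (div_lt_iff₀ hz.1).1 hn.2
    rw [div_lt_iff₀ (by positivity)]
    nlinarith [hz.1]
  have hcov : ∀ z ∈ cyl T, ∃ n, z ∈ B n := fun z hz => by
    obtain ⟨n, h1, h2, h3⟩ := hlarge z hz
    exact ⟨n, mem_box.2 ⟨h1.le, h2.le, h3.le, hz.2⟩⟩
  classical
  let w : Pt → ℝ := fun z => if h : ∃ n, z ∈ B n then W (Nat.find h) z else 0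
  have hw : ∀ n, EqOn w (W n) (B n) := fun n z hz => by
    have h : ∃ n, z ∈ B n := ⟨n, hz⟩
    simp only [w, dif_pos h]
    exact hagree (Nat.find_min' h hz) (Nat.find_spec h)
  refine ⟨w, fun z hz => ?_, ?_⟩
  · obtain ⟨n, h1, h2, h3⟩ := hlarge z hz
    have hzB : z ∈ B n := mem_box.2 ⟨h1.le, h2.le, h3.le, hz.2⟩
    have hc : ContinuousWithinAt w (B n) z := ((hWc n).congr (hw n)) z hzB
    -- The box contains a neighbourhood of `z` relative to `cyl T`, also at `t = T`, since its top
    -- face is that of the cylinder.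
    refine hc.mono_of_mem_nhdsWithin ?_
    have hopen : {u : Pt | |u.1| < n + 1 ∧ |u.2.1| < n + 1 ∧ T / ((n : ℝ) + 2) < u.2.2} ∈ 𝓝 z := by
      refine IsOpen.mem_nhds ?_ ⟨h1, h2, h3⟩
      have o1 : IsOpen {u : Pt | |u.1| < n + 1} := isOpen_lt (by fun_prop) (by fun_prop)
      have o2 : IsOpen {u : Pt | |u.2.1| < n + 1} := isOpen_lt (by fun_prop) (by fun_prop)
      have o3 : IsOpen {u : Pt | T / ((n : ℝ) + 2) < u.2.2} :=
        isOpen_lt (by fun_prop) (by fun_prop)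
      exact o1.inter (o2.inter o3)
    filter_upwards [mem_nhdsWithin_of_mem_nhds hopen, self_mem_nhdsWithin] with u hu huc
    exact mem_box.2 ⟨hu.1.le, hu.2.1.le, hu.2.2.le, huc.2⟩
  · have hU : cyl T ⊆ ⋃ n, B n := fun z hz => mem_iUnion.2 (hcov z hz)
    refine ae_restrict_of_ae_restrict_of_subset hU ?_
    refine (ae_restrict_iUnion_iff _ _).2 fun n => ?_
    filter_upwards [hWe n, ae_restrict_mem (measurableSet_box _ _ _)] with z h1 h2
    rw [h1, hw n h2]

/-! ### Products and positive parts under `L^p` convergence -/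

section LpTendsto

variable {α : Type*} [MeasurableSpace α] {μ : Measure α} {p q r : ℝ≥0∞}

/-- Convergence in `L^p` of a sequence of functions in `L^p`. -/
structure LpTendsto (p : ℝ≥0∞) (μ : Measure α) (a : ℕ → α → ℝ) (b : α → ℝ) : Prop where
  memLp : ∀ n, MemLp (a n) p μ
  memLp_lim : MemLp b p μ
  tendsto : Tendsto (fun n => eLpNorm (fun z => a n z - b z) p μ) atTop (𝓝 0)

theorem LpTendsto.const {b : α → ℝ} (hb : MemLp b p μ) : LpTendsto p μ (fun _ => b) b :=
  ⟨fun _ => hb, hb, by simp⟩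

theorem LpTendsto.add (hp : 1 ≤ p) {a c : ℕ → α → ℝ} {b d : α → ℝ} (h : LpTendsto p μ a b)
    (h' : LpTendsto p μ c d) : LpTendsto p μ (fun n z => a n z + c n z) (fun z => b z + d z) := by
  refine ⟨fun n => (h.memLp n).add (h'.memLp n), h.memLp_lim.add h'.memLp_lim, ?_⟩
  refine tendsto_of_tendsto_of_tendsto_of_le_of_le tendsto_const_nhds
    (by simpa using h.tendsto.add h'.tendsto) (fun n => zero_le) (fun n => ?_)
  have e : (fun z => a n z + c n z - (b z + d z)) =
      (fun z => a n z - b z) + fun z => c n z - d z := by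
    funext z; simp; ring
  simp only [e]
  exact eLpNorm_add_le ((h.memLp n).sub h.memLp_lim).1 ((h'.memLp n).sub h'.memLp_lim).1 hp

theorem LpTendsto.mul [ENNReal.HolderTriple p q r] (hr : 1 ≤ r) {a c : ℕ → α → ℝ}
    {b d : α → ℝ} (h : LpTendsto p μ a b) (h' : LpTendsto q μ c d) :
    LpTendsto r μ (fun n z => a n z * c n z) (fun z => b z * d z) := by
  refine ⟨fun n => (h'.memLp n).mul (h.memLp n), h'.memLp_lim.mul h.memLp_lim, ?_⟩
  have ha : ∀ n, MemLp (fun z => a n z - b z) p μ := fun n => (h.memLp n).sub h.memLp_lim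
  have hc : ∀ n, MemLp (fun z => c n z - d z) q μ := fun n => (h'.memLp n).sub h'.memLp_lim
  have lim : Tendsto (fun n =>
      eLpNorm (fun z => a n z - b z) p μ * eLpNorm (fun z => c n z - d z) q μ +
      eLpNorm (fun z => a n z - b z) p μ * eLpNorm d q μ +
      eLpNorm b p μ * eLpNorm (fun z => c n z - d z) q μ) atTop (𝓝 0) := by
    have l1 := ENNReal.Tendsto.mul h.tendsto (Or.inr ENNReal.zero_ne_top) h'.tendsto
      (Or.inr ENNReal.zero_ne_top)
    have l2 := ENNReal.Tendsto.mul_const h.tendsto (b := eLpNorm d q μ)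
      (Or.inr h'.memLp_lim.2.ne)
    have l3 := ENNReal.Tendsto.const_mul h'.tendsto (a := eLpNorm b p μ)
      (Or.inr h.memLp_lim.2.ne)
    simpa using (l1.add l2).add l3
  refine tendsto_of_tendsto_of_tendsto_of_le_of_le tendsto_const_nhds lim
    (fun n => zero_le) (fun n => ?_)
  -- `ac - bd = (a - b)(c - d) + (a - b)d + b(c - d)`, each term tending to zero by Hölder.
  have e : (fun z => a n z * c n z - b z * d z) =
      ((fun z => a n z - b z) • (fun z => c n z - d z) + (fun z => a n z - b z) • d) +
        b • fun z => c n z - d z := by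
    funext z; simp; ring
  simp only [e]
  have m1 := (ha n).1.smul (hc n).1
  have m2 := (ha n).1.smul h'.memLp_lim.1
  have m3 := h.memLp_lim.1.smul (hc n).1
  refine (eLpNorm_add_le (m1.add m2) m3 hr).trans (add_le_add ((eLpNorm_add_le m1 m2 hr).trans
    (add_le_add ?_ ?_)) ?_)
  · exact eLpNorm_smul_le_mul_eLpNorm (hc n).1 (ha n).1
  · exact eLpNorm_smul_le_mul_eLpNorm h'.memLp_lim.1 (ha n).1
  · exact eLpNorm_smul_le_mul_eLpNorm (hc n).1 h.memLp_lim.1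

theorem LpTendsto.posPart {a : ℕ → α → ℝ} {b : α → ℝ} (h : LpTendsto p μ a b) :
    LpTendsto p μ (fun n z => max (a n z) 0) (fun z => max (b z) 0) := by
  refine ⟨fun n => (h.memLp n).pos_part, h.memLp_lim.pos_part, ?_⟩
  refine tendsto_of_tendsto_of_tendsto_of_le_of_le tendsto_const_nhds h.tendsto
    (fun n => zero_le) (fun n => eLpNorm_mono fun z => ?_)
  simpa using abs_max_sub_max_le_abs (a n z) (b z) 0

theorem LpTendsto.mono_exponent [IsFiniteMeasure μ] (hqp : q ≤ p) {a : ℕ → α → ℝ}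
    {b : α → ℝ} (h : LpTendsto p μ a b) : LpTendsto q μ a b := by
  refine ⟨fun n => (h.memLp n).mono_exponent hqp, h.memLp_lim.mono_exponent hqp, ?_⟩
  rcases eq_or_ne q 0 with rfl | hq
  · simp
  refine tendsto_of_tendsto_of_tendsto_of_le_of_le tendsto_const_nhds ?_ (fun n => zero_le)
    (fun n => eLpNorm_le_eLpNorm_mul_rpow_measure_univ hqp ((h.memLp n).sub h.memLp_lim).1)
  have h1 : μ univ ^ (1 / q.toReal - 1 / p.toReal) ≠ ⊤ := by
    refine ENNReal.rpow_ne_top_of_nonneg ?_ (measure_ne_top μ univ)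
    rcases eq_or_ne p ⊤ with rfl | hp
    · simp
    · exact sub_nonneg.2 (one_div_le_one_div_of_le (ENNReal.toReal_pos hq
        (ne_top_of_le_ne_top hp hqp)) (ENNReal.toReal_mono hp hqp))
  simpa using ENNReal.Tendsto.mul_const h.tendsto (Or.inr h1)

theorem LpTendsto.tendsto_integral {a : ℕ → α → ℝ} {b : α → ℝ} (h : LpTendsto 1 μ a b) :
    Tendsto (fun n => ∫ z, a n z ∂μ) atTop (𝓝 (∫ z, b z ∂μ)) :=
  tendsto_integral_of_L1' b h.memLp_lim.1
    (Eventually.of_forall fun n => memLp_one_iff_integrable.1 (h.memLp n)) h.tendsto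

end LpTendsto

instance holderTriple_four_four_two : ENNReal.HolderTriple 4 4 2 where
  inv_add_inv_eq_inv := by
    rw [show (4 : ℝ≥0∞) = 2 * 2 by norm_num, ENNReal.mul_inv (by simp) (by simp), ← mul_add,
      ENNReal.inv_two_add_inv_two, mul_one]

/-- Pairing as `(4, 4)` and `(4, ∞)` puts both pairs in `L²`, the second because the measure is
finite. This fits the terms of the energy identity: three `L^4` factors and a bounded cutoff. -/
theorem LpTendsto.mul₄ {α : Type*} [MeasurableSpace α] {μ : Measure α} [IsFiniteMeasure μ]
    {a b c d : ℕ → α → ℝ} {a' b' c' d' : α → ℝ} (ha : LpTendsto 4 μ a a')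
    (hb : LpTendsto 4 μ b b') (hc : LpTendsto 4 μ c c') (hd : LpTendsto ⊤ μ d d') :
    LpTendsto 1 μ (fun n z => a n z * b n z * (c n z * d n z))
      (fun z => a' z * b' z * (c' z * d' z)) :=
  (ha.mul (r := 2) (by norm_num) hb).mul le_rfl
    ((hc.mul (r := 4) (by norm_num) hd).mono_exponent (q := 2) (by norm_num))

/-! ### Integration by parts against the squared positive part -/

/-- Squaring removes the kink at `0`, so the ordinary chain rule applies to smooth functions. -/
theorem hasDerivAt_posPart_sq (s : ℝ) :
    HasDerivAt (fun s : ℝ => max s 0 ^ 2) (2 * max s 0) s := by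
  rcases lt_trichotomy s 0 with h | h | h
  · have : (fun s : ℝ => max s 0 ^ 2) =ᶠ[𝓝 s] fun _ => 0 := by
      filter_upwards [gt_mem_nhds h] with u hu
      simp [max_eq_right hu.le]
    rw [max_eq_right h.le, mul_zero]
    exact (hasDerivAt_const s (0 : ℝ)).congr_of_eventuallyEq this
  · subst h
    simp only [max_self, mul_zero]
    rw [hasDerivAt_iff_isLittleO_nhds_zero]
    have h1 : (fun h : ℝ => h ^ 2) =o[𝓝 0] fun h : ℝ => h := by
      simpa using Asymptotics.isLittleO_pow_id (𝕜 := ℝ) one_lt_two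
    refine Asymptotics.IsBigO.trans_isLittleO (Asymptotics.IsBigO.of_bound 1 ?_) h1
    refine Eventually.of_forall fun h => ?_
    simp only [zero_add, max_self, smul_zero, sub_zero, one_mul, Real.norm_eq_abs, abs_pow, sq_abs]
    rcases le_total h 0 with h0 | h0
    · simp [max_eq_right h0]; positivity
    · simp [max_eq_left h0]
  · have : (fun s : ℝ => max s 0 ^ 2) =ᶠ[𝓝 s] fun s => s ^ 2 := by
      filter_upwards [lt_mem_nhds h] with u hu
      simp [max_eq_left hu.le]
    rw [max_eq_left h.le]
    simpa using (hasDerivAt_pow 2 s).congr_of_eventuallyEq this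

/-- Integration by parts against `f₊² χ`, for smooth functions. -/
theorem integral_fderiv_mul_posPart_sq {e : Pt} {f V χ : Pt → ℝ} (hf : ContDiff ℝ 1 f)
    (hV : ContDiff ℝ 1 V) (hχ : ContDiff ℝ 1 χ) (hχc : HasCompactSupport χ) :
    ∫ z, fderiv ℝ V z e * (max (f z) 0 ^ 2 * χ z) =
      - ∫ z, V z * (2 * max (f z) 0 * fderiv ℝ f z e * χ z +
        max (f z) 0 ^ 2 * fderiv ℝ χ z e) := by
  have hcf := hf.continuous
  have hcχ := hχ.continuous
  have hcV := hV.continuous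
  have hf' : Continuous fun z => fderiv ℝ f z e :=
    (hf.continuous_fderiv (by simp)).clm_apply continuous_const
  have hV' : Continuous fun z => fderiv ℝ V z e :=
    (hV.continuous_fderiv (by simp)).clm_apply continuous_const
  have hχ' : Continuous fun z => fderiv ℝ χ z e :=
    (hχ.continuous_fderiv (by simp)).clm_apply continuous_const
  have hχ'c : HasCompactSupport fun z => fderiv ℝ χ z e := hχc.fderiv_apply ℝ e
  have hd : ∀ z, HasFDerivAt (fun z => max (f z) 0 ^ 2 * χ z)
      ((max (f z) 0 ^ 2) • fderiv ℝ χ z + χ z • ((2 * max (f z) 0) • fderiv ℝ f z)) z := fun z =>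
    ((hasDerivAt_posPart_sq (f z)).comp_hasFDerivAt z
      (hf.differentiable (by simp) z).hasFDerivAt).mul
      (hχ.differentiable (by simp) z).hasFDerivAt
  have hd' : ∀ z, fderiv ℝ (fun z => max (f z) 0 ^ 2 * χ z) z e =
      2 * max (f z) 0 * fderiv ℝ f z e * χ z + max (f z) 0 ^ 2 * fderiv ℝ χ z e := fun z => by
    rw [(hd z).fderiv]; simp; ring
  have hcs : HasCompactSupport fun z => max (f z) 0 ^ 2 * χ z := hχc.mul_left
  have hcs' : HasCompactSupport fun z => 2 * max (f z) 0 * fderiv ℝ f z e * χ z +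
      max (f z) 0 ^ 2 * fderiv ℝ χ z e := hχc.mul_left.add hχ'c.mul_left
  have key := integral_mul_fderiv_eq_neg_fderiv_mul_of_integrable (μ := (volume : Measure Pt))
    (f := V) (g := fun z => max (f z) 0 ^ 2 * χ z) (v := e) ?_ ?_ ?_
    (fun z _ => hV.differentiable (by simp) z) (fun z _ => (hd z).differentiableAt)
  · simp only [hd'] at key
    rw [key, neg_neg]
  · exact (by fun_prop : Continuous fun z => fderiv ℝ V z e * (max (f z) 0 ^ 2 * χ z)
      ).integrable_of_hasCompactSupport hcs.mul_left
  · simp only [hd']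
    exact (by fun_prop : Continuous fun z => V z * (2 * max (f z) 0 * fderiv ℝ f z e * χ z +
      max (f z) 0 ^ 2 * fderiv ℝ χ z e)).integrable_of_hasCompactSupport hcs'.mul_left
  · exact (by fun_prop : Continuous fun z => V z * (max (f z) 0 ^ 2 * χ z)
      ).integrable_of_hasCompactSupport hcs.mul_left

theorem _root_.Continuous.memLp_restrict_of_isCompact {k : Pt → ℝ} (hk : Continuous k) {K : Set Pt}
    (hK : IsCompact K) {p : ℝ≥0∞} : MemLp k p (volume.restrict K) := by
  have : IsFiniteMeasure (volume.restrict K) :=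
    ⟨by rw [Measure.restrict_apply_univ]; exact hK.measure_lt_top⟩
  obtain ⟨C, hC⟩ := hK.exists_bound_of_continuousOn hk.continuousOn
  exact MemLp.of_bound hk.aestronglyMeasurable C
    ((ae_restrict_mem hK.measurableSet).mono fun z hz => hC z hz)

theorem exists_subset_box {T : ℝ} {K : Set Pt} (hK : IsCompact K) (hKT : K ⊆ cyl T) :
    ∃ R > 0, ∃ δ > 0, K ⊆ box T R δ := by
  obtain ⟨R, hR0, hR⟩ := hK.isBounded.exists_pos_norm_le
  have hδ : ∃ δ > 0, ∀ z ∈ K, δ ≤ z.2.2 := by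
    rcases K.eq_empty_or_nonempty with rfl | hne
    · exact ⟨1, one_pos, by simp⟩
    · obtain ⟨z0, h0, hmin⟩ := hK.exists_isMinOn hne
        (f := fun z : Pt => z.2.2) (by fun_prop)
      exact ⟨z0.2.2, (hKT h0).1, fun z hz => hmin hz⟩
  obtain ⟨δ, hδ0, hδ⟩ := hδ
  refine ⟨R, hR0, δ, hδ0, fun z hz => mem_box.2 ⟨?_, ?_, hδ z hz, (hKT hz).2⟩⟩
  · exact (norm_fst_le z).trans (hR z hz)
  · exact ((norm_fst_le z.2).trans (norm_snd_le z)).trans (hR z hz)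

theorem openCyl_subset_cyl (T : ℝ) : openCyl T ⊆ cyl T := fun _ hz => ⟨hz.1, hz.2.le⟩

/-- The product of three functions in `L^4_loc(Q)` and a cutoff function is integrable. -/
theorem integrable_mul_mul_mul_cutoff {T : ℝ} {f g V χ : Pt → ℝ} (hf : MemLpLoc T 4 f)
    (hg : MemLpLoc T 4 g) (hV : MemLpLoc T 4 V) (hχ : Continuous χ) (hχc : HasCompactSupport χ)
    (hχs : tsupport χ ⊆ openCyl T) :
    Integrable fun z => f z * g z * (V z * χ z) := by
  have hK := hχs.trans (openCyl_subset_cyl T)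
  have : IsFiniteMeasure (volume.restrict (tsupport χ)) :=
    ⟨by rw [Measure.restrict_apply_univ]; exact hχc.isCompact.measure_lt_top⟩
  have h4 : IntegrableOn (fun z => f z * g z * (V z * χ z)) (tsupport χ) :=
    memLp_one_iff_integrable.1 (LpTendsto.mul₄ (.const (hf _ hK hχc)) (.const (hg _ hK hχc))
      (.const (hV _ hK hχc)) (.const (hχ.memLp_top_of_hasCompactSupport hχc _))).memLp_lim
  refine (integrableOn_iff_integrable_of_support_subset fun z hz => ?_).1 h4
  exact subset_tsupport χ fun h0 => hz (by simp [h0])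

/-- Integration by parts against `f₊² χ`, for weakly differentiable functions. -/
theorem IsWeakDeriv.integral_mul_posPart_sq {T : ℝ} {e : Pt} {f g V W χ : Pt → ℝ}
    (hfg : IsWeakDeriv T e f g) (hVW : IsWeakDeriv T e V W) (hf : MemLpLoc T 4 f)
    (hg : MemLpLoc T 4 g) (hV : MemLpLoc T 4 V) (hW : MemLpLoc T 4 W)
    (hχ : ContDiff ℝ 1 χ) (hχc : HasCompactSupport χ) (hχs : tsupport χ ⊆ openCyl T) :
    ∫ z, W z * (max (f z) 0 ^ 2 * χ z) =
      - ∫ z, V z * (2 * max (f z) 0 * g z * χ z + max (f z) 0 ^ 2 * fderiv ℝ χ z e) := by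
  obtain ⟨R, hR, δ, hδ, hbox⟩ := exists_subset_box hχc (hχs.trans (openCyl_subset_cyl T))
  have h14 : (1 : ℝ≥0∞) ≤ 4 := by norm_num
  have h4t : (4 : ℝ≥0∞) ≠ ⊤ := by norm_num
  set κ : Measure Pt := volume.restrict (box T R δ) with hκ
  have : IsFiniteMeasure κ :=
    ⟨by rw [Measure.restrict_apply_univ]; exact (isCompact_box T R δ).measure_lt_top⟩
  have hchange : ∀ k : Pt → ℝ, (∀ z ∉ tsupport χ, k z = 0) → ∫ z, k z ∂κ = ∫ z, k z :=
    fun k hk => setIntegral_eq_integral_of_forall_compl_eq_zero fun z hz =>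
      hk z fun h => hz (hbox h)
  have hχ0 : ∀ z ∉ tsupport χ, χ z = 0 := fun z hz => image_eq_zero_of_notMem_tsupport hz
  have hχ'0 : ∀ z ∉ tsupport χ, fderiv ℝ χ z = 0 := fun z hz =>
    image_eq_zero_of_notMem_tsupport fun h => hz (tsupport_fderiv_subset ℝ h)
  set F := fun n => boxMollify T R δ n f
  set Y := fun n => boxMollify T R δ n V
  have hF : ∀ n, ContDiff ℝ ∞ (F n) := contDiff_boxMollify hδ h14 hf
  have hY : ∀ n, ContDiff ℝ ∞ (Y n) := contDiff_boxMollify hδ h14 hV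
  have hcont : ∀ k : Pt → ℝ, Continuous k → MemLp k 4 κ := fun k hk =>
    hk.memLp_restrict_of_isCompact (isCompact_box T R δ)
  have hmem : ∀ k, MemLpLoc T 4 k → MemLp k 4 κ := fun k hk =>
    hk _ (box_subset_cyl hδ) (isCompact_box _ _ _)
  have lF : LpTendsto 4 κ F f :=
    ⟨fun n => hcont _ (hF n).continuous, hmem f hf, tendsto_boxMollify hδ h14 h4t hf⟩
  have lY : LpTendsto 4 κ Y V :=
    ⟨fun n => hcont _ (hY n).continuous, hmem V hV, tendsto_boxMollify hδ h14 h4t hV⟩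
  have lF' : LpTendsto 4 κ (fun n z => fderiv ℝ (F n) z e) g :=
    ⟨fun n => hcont _ (((hF n).continuous_fderiv (by simp)).clm_apply continuous_const),
      hmem g hg, tendsto_fderiv_boxMollify hδ h14 h4t hfg hf hg⟩
  have lY' : LpTendsto 4 κ (fun n z => fderiv ℝ (Y n) z e) W :=
    ⟨fun n => hcont _ (((hY n).continuous_fderiv (by simp)).clm_apply continuous_const),
      hmem W hW, tendsto_fderiv_boxMollify hδ h14 h4t hVW hV hW⟩
  have lχ : LpTendsto ⊤ κ (fun _ => χ) χ :=
    .const (hχ.continuous.memLp_top_of_hasCompactSupport hχc κ)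
  have lχ' : LpTendsto ⊤ κ (fun _ z => fderiv ℝ χ z e) fun z => fderiv ℝ χ z e :=
    .const (((hχ.continuous_fderiv (by simp)).clm_apply
      continuous_const).memLp_top_of_hasCompactSupport (hχc.fderiv_apply ℝ e) κ)
  have lP := lF.posPart
  have lL := (lY'.mul₄ lP lP lχ).tendsto_integral
  have l1 := lY.mul₄ lF' lP lχ
  have lR := ((l1.add le_rfl l1).add le_rfl (lY.mul₄ lP lP lχ')).tendsto_integral
  -- The smooth identity for the mollified functions; the factor 2 is written as a repeated summand
  -- so that each summand is a product of four convergent sequences.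
  have hn : ∀ n, ∫ z, fderiv ℝ (Y n) z e * max (F n z) 0 * (max (F n z) 0 * χ z) ∂κ =
      - ∫ z, (Y n z * fderiv ℝ (F n) z e * (max (F n z) 0 * χ z) +
        Y n z * fderiv ℝ (F n) z e * (max (F n z) 0 * χ z) +
        Y n z * max (F n z) 0 * (max (F n z) 0 * fderiv ℝ χ z e)) ∂κ := by
    intro n
    rw [hchange _ fun z hz => by simp [hχ0 z hz],
      hchange _ fun z hz => by simp [hχ0 z hz, hχ'0 z hz]]
    convert integral_fderiv_mul_posPart_sq (e := e) ((hF n).of_le (by simp))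
      ((hY n).of_le (by simp)) hχ hχc using 3 with z z <;> [skip; funext z] <;> ring
  simp only [hn] at lL
  have key := tendsto_nhds_unique lL lR.neg
  rw [hchange _ fun z hz => by simp [hχ0 z hz],
    hchange _ fun z hz => by simp [hχ0 z hz, hχ'0 z hz]] at key
  convert key using 3 with z z <;> [skip; funext z] <;> ring

/-! ### Cutoffs, the energy estimate and the maximum principle -/

theorem exists_contDiff_cutoff {K U : Set Pt} (hK : IsCompact K) (hU : IsOpen U) (hKU : K ⊆ U) :
    ∃ ζ : Pt → ℝ, ContDiff ℝ ∞ ζ ∧ HasCompactSupport ζ ∧ tsupport ζ ⊆ U ∧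
      (∀ z ∈ K, ζ =ᶠ[𝓝 z] 1) ∧ ∀ z, 0 ≤ ζ z := by
  obtain ⟨L, hL, hKL, hLU⟩ := exists_compact_between hK hU hKU
  obtain ⟨f, h1, h0, h01⟩ := exists_contMDiffMap_one_nhds_of_subset_interior
    (n := (⊤ : ℕ∞)) (modelWithCornersSelf ℝ Pt) hK.isClosed hKL
  have hs : tsupport f ⊆ L := closure_minimal (fun z hz => by
    by_contra h; exact hz (h0 z h)) hL.isClosed
  exact ⟨f, f.contMDiff.contDiff, hL.of_isClosed_subset (isClosed_tsupport _) hs, hs.trans hLU,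
    fun z hz => (eventually_nhdsSet_iff_forall.1 h1) z hz, fun z => (h01 z).1⟩

/-- A smooth weight of time that vanishes from `S` on and decays at rate at least `l`. -/
theorem exists_decaying_weight (S l : ℝ) :
    ∃ θ : ℝ → ℝ, ContDiff ℝ ∞ θ ∧ (∀ t, 0 ≤ θ t) ∧ (∀ t < S, 0 < θ t) ∧ (∀ t, S ≤ t → θ t = 0) ∧
      ∀ t, deriv θ t ≤ -l * θ t := by
  refine ⟨fun t => Real.smoothTransition (S - t) * Real.exp (-l * t), ?_, ?_, ?_, ?_, ?_⟩
  · exact (Real.smoothTransition.contDiff.comp (contDiff_const.sub contDiff_id)).mul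
      (Real.contDiff_exp.comp (contDiff_const.mul contDiff_id))
  · exact fun t => mul_nonneg (Real.smoothTransition.nonneg _) (Real.exp_pos _).le
  · exact fun t ht => mul_pos (Real.smoothTransition.pos_of_pos (sub_pos.2 ht)) (Real.exp_pos _)
  · intro t ht
    simp [Real.smoothTransition.zero_of_nonpos (sub_nonpos.2 ht)]
  · intro t
    have h1 : HasDerivAt (fun t => Real.smoothTransition (S - t))
        (-deriv Real.smoothTransition (S - t)) t :=
      ((Real.smoothTransition.contDiff (n := 1)).differentiable (by simp)
        _).hasDerivAt.comp_const_sub S t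
    have h2 : HasDerivAt (fun t => Real.exp (-l * t)) (Real.exp (-l * t) * (-l * 1)) t :=
      ((hasDerivAt_id t).const_mul (-l)).exp
    have hd := (h1.mul h2).deriv
    simp only [Pi.mul_def] at hd
    rw [hd]
    have h3 : 0 ≤ deriv Real.smoothTransition (S - t) := Real.smoothTransition.monotone.deriv_nonneg
    have h4 := mul_nonneg h3 (Real.exp_pos (-l * t)).le
    linarith

theorem MemLpLoc.posPart {T : ℝ} {p : ℝ≥0∞} {f : Pt → ℝ} (hf : MemLpLoc T p f) :
    MemLpLoc T p fun z => max (f z) 0 := fun K hK hc => (hf K hK hc).pos_part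

theorem MemLpLoc.abs {T : ℝ} {p : ℝ≥0∞} {f : Pt → ℝ} (hf : MemLpLoc T p f) :
    MemLpLoc T p fun z => |f z| := fun K hK hc => (hf K hK hc).abs

/-- A function and its weak derivatives in all the directions of a parabolic equation,
all in `L^4_loc(Q)`. -/
structure IsParabolicJet (T : ℝ) (U Ut Ux Uy Uxx Uyy : Pt → ℝ) : Prop where
  memLp : MemLpLoc T 4 U
  memLp_t : MemLpLoc T 4 Ut
  memLp_x : MemLpLoc T 4 Ux
  memLp_y : MemLpLoc T 4 Uy
  memLp_xx : MemLpLoc T 4 Uxx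
  memLp_yy : MemLpLoc T 4 Uyy
  deriv_t : IsWeakDeriv T et U Ut
  deriv_x : IsWeakDeriv T ex U Ux
  deriv_y : IsWeakDeriv T ey U Uy
  deriv_xx : IsWeakDeriv T ex Ux Uxx
  deriv_yy : IsWeakDeriv T ey Uy Uyy

/-- The energy estimate: a subsolution on its positivity set vanishes wherever the cutoff function
`χ` does not, if `χ` decays fast enough in time. -/
theorem IsParabolicJet.ae_posPart_mul_eq_zero {T a₁ a₂ c c₀ B l : ℝ} (ha₁ : 0 < a₁) (ha₂ : 0 < a₂)
    (hl : 3 * (1 + c₀ + c ^ 2 / (8 * a₂) + B ^ 2 / (8 * a₁)) ≤ l)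
    {U Ut Ux Uy Uxx Uyy χ : Pt → ℝ} (hU : IsParabolicJet T U Ut Ux Uy Uxx Uyy)
    (hχ : ContDiff ℝ 1 χ) (hχc : HasCompactSupport χ) (hχs : tsupport χ ⊆ openCyl T)
    (hχ0 : ∀ z, 0 ≤ χ z)
    (hχd : ∀ᵐ z, z ∈ openCyl T → 0 < U z →
      fderiv ℝ χ z ex = 0 ∧ fderiv ℝ χ z ey = 0 ∧ fderiv ℝ χ z et ≤ -l * χ z)
    (hsub : ∀ᵐ z, z ∈ openCyl T → 0 < U z →
      Ut z ≤ a₁ * Uxx z + a₂ * Uyy z + c * Uy z + c₀ * U z + B * |Ux z|) :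
    ∀ᵐ z, max (U z) 0 * χ z = 0 := by
  set P : Pt → ℝ := fun z => max (U z) 0 with hP
  have hP4 : MemLpLoc T 4 P := hU.memLp.posPart
  have hχ' : ∀ e, Continuous fun z => fderiv ℝ χ z e := fun e =>
    (hχ.continuous_fderiv (by simp)).clm_apply continuous_const
  have hint : ∀ {f g V : Pt → ℝ}, MemLpLoc T 4 f → MemLpLoc T 4 g → MemLpLoc T 4 V →
      Integrable fun z => f z * g z * (V z * χ z) := fun hf hg hV =>
    integrable_mul_mul_mul_cutoff hf hg hV hχ.continuous hχc hχs
  have hint' : ∀ {f g V : Pt → ℝ} (e : Pt), MemLpLoc T 4 f → MemLpLoc T 4 g → MemLpLoc T 4 V →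
      Integrable fun z => f z * g z * (V z * fderiv ℝ χ z e) := fun e hf hg hV =>
    integrable_mul_mul_mul_cutoff hf hg hV (hχ' e) (hχc.fderiv_apply ℝ e)
      (((tsupport_fderiv_apply_subset ℝ e)).trans hχs)
  have hUP : ∀ z, U z * P z = P z * P z := fun z => by
    simp only [hP]
    rcases le_total (U z) 0 with h | h
    · simp [max_eq_right h]
    · simp [max_eq_left h]
  have iq1 := hint hU.memLp_t hP4 hP4
  have iq2 := hint hU.memLp_xx hP4 hP4
  have iq3 := hint hU.memLp_yy hP4 hP4
  have ir1 := hint' et hP4 hP4 hP4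
  have ir2 := hint hU.memLp_x hU.memLp_x hP4
  have ir3 := hint hU.memLp_y hU.memLp_y hP4
  have ir2' := hint' ex hU.memLp_x hP4 hP4
  have ir3' := hint' ey hU.memLp_y hP4 hP4
  have is1 := hint hU.memLp_y hP4 hP4
  have is2 := hint hP4 hP4 hP4
  have is3 := hint hU.memLp_x.abs hP4 hP4
  -- Since `U P = P²`, integrating by parts returns the same integral with factor `-2`. Solving
  -- gives `3 ∫ Uₜ P² χ = -∫ P³ χₜ`, the source of the factors 3 and 1/3.
  have et1 : ∫ z, Ut z * P z * (P z * χ z) = -(2 * ∫ z, Ut z * P z * (P z * χ z)) -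
      ∫ z, P z * P z * (P z * fderiv ℝ χ z et) := by
    have h := hU.deriv_t.integral_mul_posPart_sq hU.deriv_t hU.memLp hU.memLp_t hU.memLp
      hU.memLp_t hχ hχc hχs
    have i : Integrable fun z => -(2 * (Ut z * P z * (P z * χ z))) := (iq1.const_mul 2).neg
    rw [← integral_const_mul, ← integral_neg, ← integral_sub i ir1]
    rw [← integral_neg] at h
    convert h using 2
    · funext z; ring
    · funext z
      change -(2 * (Ut z * P z * (P z * χ z))) - P z * P z * (P z * fderiv ℝ χ z et) =
        -(U z * (2 * P z * Ut z * χ z + P z ^ 2 * fderiv ℝ χ z et))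
      linear_combination (2 * Ut z * χ z + P z * fderiv ℝ χ z et) * hUP z
  have espace : ∀ {e : Pt} {V W : Pt → ℝ}, IsWeakDeriv T e U V → IsWeakDeriv T e V W →
      MemLpLoc T 4 V → MemLpLoc T 4 W →
      ∫ z, W z * P z * (P z * χ z) = -(2 * ∫ z, V z * V z * (P z * χ z)) -
        ∫ z, V z * P z * (P z * fderiv ℝ χ z e) := by
    intro e V W hV hW hV4 hW4
    have h := hV.integral_mul_posPart_sq hW hU.memLp hV4 hV4 hW4 hχ hχc hχs
    have i : Integrable fun z => -(2 * (V z * V z * (P z * χ z))) :=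
      ((hint hV4 hV4 hP4).const_mul 2).neg
    rw [← integral_const_mul, ← integral_neg, ← integral_sub i (hint' e hV4 hP4 hP4)]
    rw [← integral_neg] at h
    convert h using 2 <;> funext z <;> simp only [hP] <;> ring
  have exx := espace hU.deriv_x hU.deriv_xx hU.memLp_x hU.memLp_xx
  have eyy := espace hU.deriv_y hU.deriv_yy hU.memLp_y hU.memLp_yy
  have hχout : ∀ z ∉ openCyl T, χ z = 0 ∧ fderiv ℝ χ z = 0 := fun z hz =>
    ⟨image_eq_zero_of_notMem_tsupport fun h => hz (hχs h),
      image_eq_zero_of_notMem_tsupport fun h => hz (hχs (tsupport_fderiv_subset ℝ h))⟩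
  have hcase : ∀ᵐ z, P z * χ z = 0 ∧ P z * fderiv ℝ χ z ex = 0 ∧ P z * fderiv ℝ χ z ey = 0 ∧
      P z * fderiv ℝ χ z et = 0 ∨ P z = U z ∧ 0 < P z ∧ fderiv ℝ χ z ex = 0 ∧
      fderiv ℝ χ z ey = 0 ∧ fderiv ℝ χ z et ≤ -l * χ z ∧
      Ut z ≤ a₁ * Uxx z + a₂ * Uyy z + c * Uy z + c₀ * U z + B * |Ux z| := by
    filter_upwards [hχd, hsub] with z h1 h2
    by_cases hz : z ∈ openCyl T
    · rcases le_or_gt (U z) 0 with h | h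
      · left; simp [hP, max_eq_right h]
      · right
        obtain ⟨k1, k2, k3⟩ := h1 hz h
        have hPU : P z = U z := max_eq_left h.le
        exact ⟨hPU, hPU ▸ h, k1, k2, k3, h2 hz h⟩
    · left; simp [hχout z hz]
  -- The differential inequality multiplied by `P² χ` and integrated.
  have h1 := integral_mono_ae iq1 (((((iq2.const_mul a₁).add (iq3.const_mul a₂)).add
    (is1.const_mul c)).add (is2.const_mul c₀)).add (is3.const_mul B)) (by
      filter_upwards [hcase] with z hz
      simp only [Pi.add_apply]
      rcases hz with ⟨k0, -⟩ | ⟨kU, kP, -, -, -, k⟩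
      · simp [k0]
      · have hw : 0 ≤ P z * (P z * χ z) := mul_nonneg kP.le (mul_nonneg kP.le (hχ0 z))
        rw [← kU] at k
        linarith [mul_le_mul_of_nonneg_right k hw])
  rw [integral_add' ((((iq2.const_mul a₁).add (iq3.const_mul a₂)).add
    (is1.const_mul c)).add (is2.const_mul c₀)) (is3.const_mul B),
    integral_add' (((iq2.const_mul a₁).add (iq3.const_mul a₂)).add
    (is1.const_mul c)) (is2.const_mul c₀), integral_add' ((iq2.const_mul a₁).add
    (iq3.const_mul a₂)) (is1.const_mul c), integral_add' (iq2.const_mul a₁)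
    (iq3.const_mul a₂)] at h1
  -- The lower-order terms, plus a spare copy of `∫ P³ χ`, are dominated by the decay of `χ` in time
  -- and by the gradient terms from integration by parts. The spare copy is what forces `∫ P³ χ ≤ 0`
  -- once `h1` is combined with this.
  have h2 := integral_mono_ae (((is2.add (is1.const_mul c)).add (is2.const_mul c₀)).add
    (is3.const_mul B)) (((((ir1.const_mul (-(1 / 3))).add (ir2.const_mul (2 * a₁))).add
    (ir3.const_mul (2 * a₂))).add (ir2'.const_mul a₁)).add (ir3'.const_mul a₂)) (by
      filter_upwards [hcase] with z hz
      simp only [Pi.add_apply]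
      rcases hz with ⟨k0, k1, k2, k3⟩ | ⟨-, kP, kx, ky, kt, -⟩
      · simp [k0, k1, k2, k3]
      · rw [kx, ky]
        -- Completing the squares absorbs the first-order terms into the gradient terms; the
        -- leftovers are the quotients by `8 * a₂` and `8 * a₁` in `hl`.
        have e1 : 0 ≤ 2 * a₂ * (Uy z - c * P z / (4 * a₂)) ^ 2 := by positivity
        have e2 : 0 ≤ 2 * a₁ * (|Ux z| - B * P z / (4 * a₁)) ^ 2 := by positivity
        have e3 : 2 * a₂ * (Uy z - c * P z / (4 * a₂)) ^ 2 =
            2 * a₂ * Uy z ^ 2 - c * Uy z * P z + c ^ 2 / (8 * a₂) * P z ^ 2 := by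
          field_simp; ring
        have e4 : 2 * a₁ * (|Ux z| - B * P z / (4 * a₁)) ^ 2 =
            2 * a₁ * Ux z ^ 2 - B * |Ux z| * P z + B ^ 2 / (8 * a₁) * P z ^ 2 := by
          rw [← sq_abs (Ux z)]; field_simp; ring
        have e5 : P z ^ 2 * χ z * (3 * (1 + c₀ + c ^ 2 / (8 * a₂) + B ^ 2 / (8 * a₁))) ≤
            -(P z ^ 2 * fderiv ℝ χ z et) := by
          have := mul_le_mul_of_nonneg_left hl (mul_nonneg (sq_nonneg (P z)) (hχ0 z))
          linarith [mul_le_mul_of_nonneg_left kt (sq_nonneg (P z))]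
        rw [e3] at e1
        rw [e4] at e2
        have e6 := mul_nonneg (hχ0 z) (add_nonneg e1 e2)
        have e7 : 0 ≤ χ z * (2 * a₂ * Uy z ^ 2 - c * Uy z * P z + 2 * a₁ * Ux z ^ 2 -
            B * |Ux z| * P z - (1 + c₀) * P z ^ 2) - 1 / 3 * (P z ^ 2 * fderiv ℝ χ z et) := by
          linarith
        linarith [mul_nonneg kP.le e7])
  rw [integral_add' ((is2.add (is1.const_mul c)).add (is2.const_mul c₀)) (is3.const_mul B),
    integral_add' (is2.add (is1.const_mul c)) (is2.const_mul c₀),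
    integral_add' is2 (is1.const_mul c),
    integral_add' ((((ir1.const_mul (-(1 / 3))).add (ir2.const_mul (2 * a₁))).add
    (ir3.const_mul (2 * a₂))).add (ir2'.const_mul a₁)) (ir3'.const_mul a₂),
    integral_add' (((ir1.const_mul (-(1 / 3))).add (ir2.const_mul (2 * a₁))).add
    (ir3.const_mul (2 * a₂))) (ir2'.const_mul a₁),
    integral_add' ((ir1.const_mul (-(1 / 3))).add (ir2.const_mul (2 * a₁)))
    (ir3.const_mul (2 * a₂)),
    integral_add' (ir1.const_mul (-(1 / 3))) (ir2.const_mul (2 * a₁))] at h2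
  simp only [integral_const_mul] at h1 h2
  have h3 : ∫ z, P z * P z * (P z * χ z) ≤ 0 := by
    rw [exx, eyy] at h1
    linarith
  have hnn : ∀ z, 0 ≤ P z * P z * (P z * χ z) := fun z => by
    have : 0 ≤ P z := le_max_right _ _
    have := hχ0 z
    positivity
  have h4 := (integral_eq_zero_iff_of_nonneg hnn is2).1 (le_antisymm h3 (integral_nonneg hnn))
  filter_upwards [h4] with z hz
  have : P z = 0 ∨ χ z = 0 := by simpa using hz
  change P z * χ z = 0
  rcases this with h | h <;> simp [h]

/-- The maximum principle for a subsolution whose positivity set stays in a bounded region away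
from the initial time. -/
theorem IsParabolicJet.ae_nonpos {T a₁ a₂ c c₀ B R δ : ℝ} (ha₁ : 0 < a₁) (ha₂ : 0 < a₂)
    (hδ : 0 < δ) {U Ut Ux Uy Uxx Uyy : Pt → ℝ} (hU : IsParabolicJet T U Ut Ux Uy Uxx Uyy)
    (hsupp : ∀ᵐ z : Pt, z ∈ openCyl T → 0 < U z → |z.1| ≤ R ∧ |z.2.1| ≤ R ∧ δ ≤ z.2.2)
    (hsub : ∀ᵐ z, z ∈ openCyl T → 0 < U z →
      Ut z ≤ a₁ * Uxx z + a₂ * Uyy z + c * Uy z + c₀ * U z + B * |Ux z|) :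
    ∀ᵐ z, z ∈ openCyl T → U z ≤ 0 := by
  have main : ∀ n : ℕ, ∀ᵐ z : Pt, z ∈ openCyl T → z.2.2 < T - 1 / ((n : ℝ) + 1) → U z ≤ 0 := by
    intro n
    -- The cutoff must have compact support in the open cylinder, so the estimate is made up to a
    -- time `S < T` and then `S → T`.
    set S := T - 1 / ((n : ℝ) + 1)
    have hS : S < T := sub_lt_self _ (by positivity)
    have hK : box S R δ ⊆ openCyl T := fun z hz => by
      obtain ⟨-, -, h3, h4⟩ := mem_box.1 hz
      exact ⟨hδ.trans_le h3, h4.trans_lt hS⟩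
    obtain ⟨ζ, hζ, hζc, hζs, hζ1, hζ0⟩ :=
      exists_contDiff_cutoff (isCompact_box S R δ) (isOpen_openCyl T) hK
    set l := 3 * (1 + c₀ + c ^ 2 / (8 * a₂) + B ^ 2 / (8 * a₁))
    obtain ⟨θ, hθ, hθ0, hθpos, hθS, hθ'⟩ := exists_decaying_weight S l
    have hθp : ContDiff ℝ ∞ fun z : Pt => θ z.2.2 := hθ.comp (contDiff_snd.comp contDiff_snd)
    have hfd : ∀ z e : Pt, fderiv ℝ (fun z => ζ z * θ z.2.2) z e =
        ζ z * (deriv θ z.2.2 * e.2.2) + θ z.2.2 * fderiv ℝ ζ z e := by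
      intro z e
      have h1 : HasFDerivAt (fun z : Pt => θ z.2.2) (deriv θ z.2.2 •
          (ContinuousLinearMap.snd ℝ ℝ ℝ).comp (ContinuousLinearMap.snd ℝ ℝ (ℝ × ℝ))) z :=
        (hθ.differentiable (by simp) z.2.2).hasDerivAt.comp_hasFDerivAt z
          ((ContinuousLinearMap.snd ℝ ℝ ℝ).comp
            (ContinuousLinearMap.snd ℝ ℝ (ℝ × ℝ))).hasFDerivAt
      have h2 := ((hζ.differentiable (by simp) z).hasFDerivAt.mul h1).fderiv
      simp only [Pi.mul_def] at h2
      rw [h2]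
      simp
    have key := hU.ae_posPart_mul_eq_zero (c := c) (c₀ := c₀) (B := B)
      (χ := fun z => ζ z * θ z.2.2) ha₁ ha₂ le_rfl
      ((hζ.mul hθp).of_le (by simp)) hζc.mul_right
      ((closure_mono (fun z hz => left_ne_zero_of_mul hz)).trans hζs)
      (fun z => mul_nonneg (hζ0 z) (hθ0 _)) (by
        filter_upwards [hsupp] with z h hz hUz
        obtain ⟨h1, h2, h3⟩ := h hz hUz
        -- On the positivity set, either `θ` vanishes (`t ≥ S`) or the point is in the box, near
        -- which `ζ` is constantly 1.
        have hloc : ∀ e : Pt, θ z.2.2 * fderiv ℝ ζ z e = 0 := fun e => by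
          rcases le_or_gt S z.2.2 with ht | ht
          · rw [hθS _ ht, zero_mul]
          · have : fderiv ℝ ζ z = 0 := by
              rw [(hζ1 z (mem_box.2 ⟨h1, h2, h3, ht.le⟩)).fderiv_eq]
              exact fderiv_const_apply (1 : ℝ)
            simp [this]
        refine ⟨by simp [hfd, hloc, ex], by simp [hfd, hloc, ey], ?_⟩
        rw [hfd, hloc, et, add_zero, mul_one]
        linarith [mul_le_mul_of_nonneg_left (hθ' z.2.2) (hζ0 z)]) hsub
    filter_upwards [key, hsupp] with z h1 h2 hz ht
    by_contra! h
    obtain ⟨k1, k2, k3⟩ := h2 hz h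
    have hζz : ζ z = 1 := (hζ1 z (mem_box.2 ⟨k1, k2, k3, ht.le⟩)).self_of_nhds
    rw [max_eq_left h.le, hζz, one_mul] at h1
    exact (mul_pos h (hθpos _ ht)).ne' h1
  filter_upwards [ae_all_iff.2 main] with z hz hzT
  obtain ⟨n, hn⟩ := exists_nat_one_div_lt (sub_pos.2 hzT.2)
  exact hz n hzT (by linarith)

/-! ### Algebra of weak derivatives and jets of solutions -/

theorem MemLpLoc.sub {T : ℝ} {p : ℝ≥0∞} {f g : Pt → ℝ} (hf : MemLpLoc T p f)
    (hg : MemLpLoc T p g) : MemLpLoc T p fun z => f z - g z :=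
  fun K hK hc => (hf K hK hc).sub (hg K hK hc)

theorem integrable_mul_of_tsupport_subset {T : ℝ} {f φ : Pt → ℝ}
    (hf : LocallyIntegrableOn f (openCyl T)) (hφ : Continuous φ) (hc : HasCompactSupport φ)
    (hs : tsupport φ ⊆ openCyl T) : Integrable fun z => f z * φ z := by
  have h1 : IntegrableOn (fun z => f z * φ z) (tsupport φ) :=
    ((hf.mono_set hs).integrableOn_isCompact hc).mul_continuousOn hφ.continuousOn hc
  refine (integrableOn_iff_integrable_of_support_subset fun z hz => ?_).1 h1
  exact subset_tsupport φ fun h0 => hz (by simp [h0])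

theorem IsWeakDeriv.sub {T : ℝ} {e : Pt} {f g f' g' : Pt → ℝ} (hf : IsWeakDeriv T e f f')
    (hg : IsWeakDeriv T e g g') :
    IsWeakDeriv T e (fun z => f z - g z) fun z => f' z - g' z := by
  refine ⟨hf.locInt_left.sub hg.locInt_left, hf.locInt_right.sub hg.locInt_right,
    fun φ hφ hc hs => ?_⟩
  have hd : Continuous fun z => fderiv ℝ φ z e :=
    (hφ.continuous_fderiv (by simp)).clm_apply continuous_const
  have hdc : HasCompactSupport fun z => fderiv ℝ φ z e := hc.fderiv_apply ℝ e
  have hds := (tsupport_fderiv_apply_subset ℝ (f := φ) e).trans hs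
  simp only [sub_mul]
  rw [integral_sub (integrable_mul_of_tsupport_subset hf.locInt_left hd hdc hds)
    (integrable_mul_of_tsupport_subset hg.locInt_left hd hdc hds),
    integral_sub (integrable_mul_of_tsupport_subset hf.locInt_right hφ.continuous hc hs)
    (integrable_mul_of_tsupport_subset hg.locInt_right hφ.continuous hc hs),
    hf.integral_eq φ hφ hc hs, hg.integral_eq φ hφ hc hs]
  ring

/-- A continuous directional derivative is a weak derivative. -/
theorem IsWeakDeriv.of_hasLineDerivAt {T : ℝ} {e : Pt} {f g : Pt → ℝ} (hf : Continuous f)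
    (hg : Continuous g) (h : ∀ z, HasLineDerivAt ℝ f (g z) z e) : IsWeakDeriv T e f g := by
  refine ⟨hf.locallyIntegrable.locallyIntegrableOn _, hg.locallyIntegrable.locallyIntegrableOn _,
    fun φ hφ hc hs => ?_⟩
  have hd : Continuous fun z => fderiv ℝ φ z e :=
    (hφ.continuous_fderiv (by simp)).clm_apply continuous_const
  have hdc : HasCompactSupport fun z => fderiv ℝ φ z e := hc.fderiv_apply ℝ e
  exact integral_bilinear_hasLineDerivAt_right_eq_neg_left_of_integrable
    (μ := (volume : Measure Pt)) (B := ContinuousLinearMap.mul ℝ ℝ)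
    ((hg.mul hφ.continuous).integrable_of_hasCompactSupport hc.mul_left)
    ((hf.mul hd).integrable_of_hasCompactSupport hdc.mul_left)
    ((hf.mul hφ.continuous).integrable_of_hasCompactSupport hc.mul_left)
    (fun z _ => h z)
    (fun z _ => (hφ.differentiable (by simp) z).hasFDerivAt.hasLineDerivAt e)

theorem _root_.Continuous.memLpLoc {T : ℝ} {p : ℝ≥0∞} {f : Pt → ℝ} (hf : Continuous f) :
    MemLpLoc T p f := fun _ _ hc => hf.memLp_restrict_of_isCompact hc

theorem IsParabolicJet.sub {T : ℝ} {U Ut Ux Uy Uxx Uyy V Vt Vx Vy Vxx Vyy : Pt → ℝ}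
    (hU : IsParabolicJet T U Ut Ux Uy Uxx Uyy) (hV : IsParabolicJet T V Vt Vx Vy Vxx Vyy) :
    IsParabolicJet T (fun z => U z - V z) (fun z => Ut z - Vt z) (fun z => Ux z - Vx z)
      (fun z => Uy z - Vy z) (fun z => Uxx z - Vxx z) (fun z => Uyy z - Vyy z) :=
  ⟨hU.memLp.sub hV.memLp, hU.memLp_t.sub hV.memLp_t, hU.memLp_x.sub hV.memLp_x,
    hU.memLp_y.sub hV.memLp_y, hU.memLp_xx.sub hV.memLp_xx, hU.memLp_yy.sub hV.memLp_yy,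
    hU.deriv_t.sub hV.deriv_t, hU.deriv_x.sub hV.deriv_x, hU.deriv_y.sub hV.deriv_y,
    hU.deriv_xx.sub hV.deriv_xx, hU.deriv_yy.sub hV.deriv_yy⟩

theorem MemSolutionSpace.isParabolicJet {T : ℝ} {v : Pt → ℝ} (hv : MemSolutionSpace T v) :
    IsParabolicJet T v (weakDeriv T et v) (weakDeriv T ex v) (weakDeriv T ey v)
      (weakDeriv T ex (weakDeriv T ex v)) (weakDeriv T ey (weakDeriv T ey v)) := by
  have h := hv.2 4 (by norm_num) (by simp)
  exact ⟨h.memLpLoc, h.deriv_t.2, h.deriv_x.2, h.deriv_y.2, h.deriv_xx.2, h.deriv_yy.2,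
    h.deriv_t.1.isWeakDeriv, h.deriv_x.1.isWeakDeriv, h.deriv_y.1.isWeakDeriv,
    h.deriv_xx.1.isWeakDeriv, h.deriv_yy.1.isWeakDeriv⟩

theorem MemSolutionSpace.exists_continuousOn {T : ℝ} (hT : 0 < T) {v : Pt → ℝ}
    (hv : MemSolutionSpace T v) :
    ∃ w : Pt → ℝ, ContinuousOn w (cyl T) ∧ v =ᵐ[volume.restrict (cyl T)] w :=
  have h := hv.isParabolicJet
  exists_continuousOn_cyl hT h.deriv_x h.deriv_y h.deriv_t h.memLp h.memLp_x h.memLp_y h.memLp_t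

theorem MemSolutionSpace.exists_ae_bound {T : ℝ} {v : Pt → ℝ} (hv : MemSolutionSpace T v) :
    ∃ M : ℝ, ∀ᵐ z ∂(volume.restrict (cyl T)), |v z| ≤ M := by
  refine ⟨(eLpNorm v ⊤ (volume.restrict (cyl T))).toReal, ?_⟩
  have h := hv.1.2.ne
  rw [eLpNorm_exponent_top] at h ⊢
  filter_upwards [ae_le_eLpNormEssSup (f := v) (μ := volume.restrict (cyl T))] with z hz
  have := ENNReal.toReal_mono h hz
  simpa using this

/-! ### The barrier at infinity -/

noncomputable section

/-- The spatial profile of the barrier function. -/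
def barrierProfile (z : Pt) : ℝ :=
  1 + z.1 ^ 2 + Real.exp (2 * z.2.1) + Real.exp (-2 * z.2.1)

/-- A function growing in every spatial direction, used as a barrier at infinity. -/
def barrier (ε l : ℝ) (z : Pt) : ℝ := ε * Real.exp (l * z.2.2) * barrierProfile z

end

theorem hasLineDerivAt_of_eq {F : Pt → ℝ} {z e : Pt} {k : ℝ → ℝ} {d d' : ℝ}
    (h : HasDerivAt k d 0) (hk : ∀ s : ℝ, F (z + s • e) = k s) (hd : d' = d) :
    HasLineDerivAt ℝ F d' z e := by
  rw [HasLineDerivAt, funext hk, hd]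
  exact h

theorem isParabolicJet_barrier (T ε l : ℝ) :
    IsParabolicJet T (barrier ε l) (fun z => l * barrier ε l z)
      (fun z => ε * Real.exp (l * z.2.2) * (2 * z.1))
      (fun z => ε * Real.exp (l * z.2.2) *
        (2 * Real.exp (2 * z.2.1) - 2 * Real.exp (-2 * z.2.1)))
      (fun z => ε * Real.exp (l * z.2.2) * 2)
      (fun z => ε * Real.exp (l * z.2.2) *
        (4 * Real.exp (2 * z.2.1) + 4 * Real.exp (-2 * z.2.1))) := by
  have hE : ∀ a b : ℝ,
      HasDerivAt (fun s : ℝ => Real.exp (a * (b + s))) (Real.exp (a * b) * a) 0 := by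
    intro a b
    have := (((hasDerivAt_id (0 : ℝ)).const_add b).const_mul a).exp
    simpa using this
  have c0 : Continuous (barrier ε l) := by unfold barrier barrierProfile; fun_prop
  have ct : Continuous fun z => l * barrier ε l z := by fun_prop
  refine ⟨c0.memLpLoc, ct.memLpLoc, Continuous.memLpLoc (by fun_prop),
    Continuous.memLpLoc (by fun_prop), Continuous.memLpLoc (by fun_prop),
    Continuous.memLpLoc (by fun_prop), .of_hasLineDerivAt c0 ct fun z => ?_,
    .of_hasLineDerivAt c0 (by fun_prop) fun z => ?_,
    .of_hasLineDerivAt c0 (by fun_prop) fun z => ?_,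
    .of_hasLineDerivAt (by fun_prop) (by fun_prop) fun z => ?_,
    .of_hasLineDerivAt (by fun_prop) (by fun_prop) fun z => ?_⟩
  · refine hasLineDerivAt_of_eq (((hE l z.2.2).const_mul ε).mul_const (barrierProfile z))
      (fun s => ?_) ?_
    · simp [barrier, barrierProfile, et]
    · simp only [barrier]; ring
  · refine hasLineDerivAt_of_eq (((((hasDerivAt_id (0 : ℝ)).const_add z.1).pow 2).add_const
      (1 + Real.exp (2 * z.2.1) + Real.exp (-2 * z.2.1))).const_mul
      (ε * Real.exp (l * z.2.2))) (fun s => ?_) ?_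
    · simp [barrier, barrierProfile, ex]; left; ring
    · simp
  · refine hasLineDerivAt_of_eq ((((hE 2 z.2.1).add (hE (-2) z.2.1)).add_const
      (1 + z.1 ^ 2)).const_mul (ε * Real.exp (l * z.2.2))) (fun s => ?_) ?_
    · simp [barrier, barrierProfile, ey]; left; ring
    · ring
  · refine hasLineDerivAt_of_eq ((((hasDerivAt_id (0 : ℝ)).const_add z.1).const_mul 2).const_mul
      (ε * Real.exp (l * z.2.2))) (fun s => ?_) ?_
    · simp [ex]
    · simp
  · refine hasLineDerivAt_of_eq ((((hE 2 z.2.1).const_mul 2).sub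
      ((hE (-2) z.2.1).const_mul 2)).const_mul (ε * Real.exp (l * z.2.2))) (fun s => ?_) ?_
    · simp [ey]
    · ring

theorem abs_fst_le_barrierProfile (z : Pt) : |z.1| ≤ barrierProfile z := by
  have h1 := Real.exp_pos (2 * z.2.1)
  have h2 := Real.exp_pos (-2 * z.2.1)
  have h3 : |z.1| ≤ 1 + z.1 ^ 2 := by
    rw [← sq_abs z.1]; nlinarith [sq_nonneg (|z.1| - 1), abs_nonneg z.1]
  unfold barrierProfile; linarith

theorem abs_snd_le_barrierProfile (z : Pt) : |z.2.1| ≤ barrierProfile z := by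
  have h1 := Real.add_one_le_exp (2 * z.2.1)
  have h2 := Real.add_one_le_exp (-2 * z.2.1)
  have h3 := Real.exp_pos (2 * z.2.1)
  have h4 := Real.exp_pos (-2 * z.2.1)
  unfold barrierProfile
  rw [abs_le]
  constructor <;> nlinarith [sq_nonneg z.1]

theorem one_le_barrierProfile (z : Pt) : 1 ≤ barrierProfile z := by
  unfold barrierProfile
  have h3 := Real.exp_pos (2 * z.2.1)
  have h4 := Real.exp_pos (-2 * z.2.1)
  nlinarith [sq_nonneg z.1]

/-! ### Linearization and comparison almost everywhere -/

/-- At a point where `v₁ < v₂`, the variational inequality gives a differential inequality for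
`v₂ - v₁`. -/
theorem sub_le_of_max_le_max {L₁ L₂ v₁ v₂ d₁ d₂ q M : ℝ} (hq : 0 ≤ q)
    (hF : max (L₂ + q * v₂ * d₂) (v₂ - 1) ≤ max (L₁ + q * v₁ * d₁) (v₁ - 1))
    (hd : 0 ≤ max d₁ d₂) (h₁ : |v₁| ≤ M) (h₂ : |v₂| ≤ M) (hv : v₁ < v₂) :
    L₂ - L₁ ≤ q * M * |d₂ - d₁| := by
  -- Because `v₁ - 1 < v₂ - 1`, the obstacle branch cannot attain the maximum for `v₁`.
  have hL : L₂ + q * v₂ * d₂ ≤ L₁ + q * v₁ * d₁ := by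
    rcases le_max_iff.1 ((le_max_left _ _).trans hF) with h | h
    · exact h
    · rcases le_max_iff.1 ((le_max_right _ _).trans hF) with h' | h' <;> rcases max_cases
        (L₁ + q * v₁ * d₁) (v₁ - 1) with ⟨_, k⟩ | ⟨_, k⟩ <;> linarith
  -- If `d₁ ≥ 0`, write the left side as `v₂ (d₁ - d₂) - (v₂ - v₁) d₁`; if `d₂ ≥ 0`, as `v₁ (d₁ -
  -- d₂) - (v₂ - v₁) d₂`. The last term is nonpositive either way.
  have key : v₁ * d₁ - v₂ * d₂ ≤ M * |d₂ - d₁| := by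
    have aux : ∀ v : ℝ, |v| ≤ M → v * (d₁ - d₂) ≤ M * |d₂ - d₁| := fun v hvM =>
      calc v * (d₁ - d₂) ≤ |v * (d₁ - d₂)| := le_abs_self _
        _ = |v| * |d₂ - d₁| := by rw [abs_mul, abs_sub_comm]
        _ ≤ M * |d₂ - d₁| := by gcongr
    rcases le_max_iff.1 hd with h | h
    · linarith [aux v₂ h₂, mul_nonneg (sub_pos.2 hv).le h]
    · linarith [aux v₁ h₁, mul_nonneg (sub_pos.2 hv).le h]
  linarith [mul_le_mul_of_nonneg_left key hq]

/-- The barrier is a supersolution for every drift `q b` with `|b| ≤ M` and `q = e^y / m`. -/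
theorem barrier_supersolution {a₁ a₂ c c₀ κ l ε : ℝ} (ha₁ : 0 ≤ a₁) (ha₂ : 0 ≤ a₂) (hc : 0 ≤ c)
    (hκ : 0 ≤ κ) (hε : 0 ≤ ε) (hl : l = 4 * a₂ + 2 * a₁ + 2 * c + c₀ + κ) (z : Pt) :
    a₁ * (ε * Real.exp (l * z.2.2) * 2) + a₂ * (ε * Real.exp (l * z.2.2) *
        (4 * Real.exp (2 * z.2.1) + 4 * Real.exp (-2 * z.2.1))) +
      c * (ε * Real.exp (l * z.2.2) *
        (2 * Real.exp (2 * z.2.1) - 2 * Real.exp (-2 * z.2.1))) +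
      c₀ * barrier ε l z + κ * Real.exp z.2.1 * |ε * Real.exp (l * z.2.2) * (2 * z.1)| ≤
      l * barrier ε l z := by
  set E := ε * Real.exp (l * z.2.2) with hE
  have hE0 : 0 ≤ E := by positivity
  set p := Real.exp (2 * z.2.1)
  set n := Real.exp (-2 * z.2.1)
  have hp : 0 < p := Real.exp_pos _
  have hn : 0 < n := Real.exp_pos _
  have hp2 : p = Real.exp z.2.1 ^ 2 := by rw [← Real.exp_nat_mul]; simp [p]
  have hb : barrier ε l z = E * (1 + z.1 ^ 2 + p + n) := rfl
  -- The reason for `x²` and `e^{2y}` in the profile: `2 e^y |x| ≤ e^{2y} + x²`.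
  have hx : Real.exp z.2.1 * |E * (2 * z.1)| ≤ E * (1 + z.1 ^ 2 + p + n) := by
    rw [abs_mul, abs_of_nonneg hE0, abs_mul, abs_two]
    have h1 : Real.exp z.2.1 * (2 * |z.1|) ≤ 1 + z.1 ^ 2 + p + n := by
      rw [hp2, ← sq_abs z.1]
      nlinarith [sq_nonneg (Real.exp z.2.1 - |z.1|)]
    linarith [mul_le_mul_of_nonneg_left h1 hE0]
  have b1 : a₁ * (E * 2) ≤ 2 * a₁ * (E * (1 + z.1 ^ 2 + p + n)) := by
    have : E * 1 ≤ E * (1 + z.1 ^ 2 + p + n) := by gcongr; nlinarith [sq_nonneg z.1]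
    linarith [mul_le_mul_of_nonneg_left this ha₁]
  have b2 : a₂ * (E * (4 * p + 4 * n)) ≤ 4 * a₂ * (E * (1 + z.1 ^ 2 + p + n)) := by
    have : E * (p + n) ≤ E * (1 + z.1 ^ 2 + p + n) := by gcongr; nlinarith [sq_nonneg z.1]
    linarith [mul_le_mul_of_nonneg_left this ha₂]
  have b3 : c * (E * (2 * p - 2 * n)) ≤ 2 * c * (E * (1 + z.1 ^ 2 + p + n)) := by
    have : E * (p - n) ≤ E * (1 + z.1 ^ 2 + p + n) := by gcongr; nlinarith [sq_nonneg z.1]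
    linarith [mul_le_mul_of_nonneg_left this hc]
  rw [hb]
  have hl' : l * (E * (1 + z.1 ^ 2 + p + n)) = _ := congrArg (· * (E * (1 + z.1 ^ 2 + p + n))) hl
  rw [hl']
  linarith [mul_le_mul_of_nonneg_left hx hκ]

/-- The comparison principle, almost everywhere in `ℝ² × (0, T)`. -/
theorem ae_le_of_opF_le {T σ ν μ r m : ℝ} (hσ : 0 < σ) (hν : 0 < ν) (hμ : 0 < μ)
    (hm : 0 < m) (hμr : r < μ) {v₁ v₂ : Pt → ℝ}
    (hv₁ : MemSolutionSpace T v₁) (hv₂ : MemSolutionSpace T v₂)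
    (hi₁ : GaussianInitial T ν v₁) (hi₂ : GaussianInitial T ν v₂)
    (hF : ∀ᵐ z ∂(volume.restrict (cyl T)), opF T σ ν μ r m v₂ z ≤ opF T σ ν μ r m v₁ z)
    (hmon : ∀ᵐ z ∂(volume.restrict (cyl T)),
      0 ≤ max (weakDeriv T ex v₁ z) (weakDeriv T ex v₂ z)) :
    ∀ᵐ z, z ∈ openCyl T → v₂ z ≤ v₁ z := by
  have hrestr : ∀ {p : Pt → Prop}, (∀ᵐ z ∂(volume.restrict (cyl T)), p z) →
      ∀ᵐ z, z ∈ openCyl T → p z := fun h =>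
    (ae_restrict_iff' (isOpen_openCyl T).measurableSet).1
      (ae_restrict_of_ae_restrict_of_subset (openCyl_subset_cyl T) h)
  obtain ⟨M₁, hM₁⟩ := hv₁.exists_ae_bound
  obtain ⟨M₂, hM₂⟩ := hv₂.exists_ae_bound
  set M := max (max M₁ M₂) 0
  have hM0 : 0 ≤ M := le_max_right _ _
  have hMM₁ : M₁ ≤ M := (le_max_left _ _).trans (le_max_left _ _)
  have hMM₂ : M₂ ≤ M := (le_max_right _ _).trans (le_max_left _ _)
  have ha₁ : 0 < ν ^ 2 / 2 := by positivity
  have ha₂ : 0 < σ ^ 2 / 2 := by positivity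
  have hc : 0 < μ + σ ^ 2 / 2 := by positivity
  have hκ : 0 ≤ M / m := by positivity
  obtain ⟨l, hl⟩ : ∃ l, l = 4 * (σ ^ 2 / 2) + 2 * (ν ^ 2 / 2) + 2 * (μ + σ ^ 2 / 2) + (μ - r) +
    M / m := ⟨_, rfl⟩
  have hl0 : 0 ≤ l := by rw [hl]; have := sub_pos.2 hμr; positivity
  have main : ∀ ε > 0, ∀ᵐ z, z ∈ openCyl T → v₂ z - v₁ z - barrier ε l z ≤ 0 := by
    intro ε hε
    have hbar : ∀ z ∈ openCyl T, ε * barrierProfile z ≤ barrier ε l z := fun z hz => by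
      have h1 : 1 ≤ Real.exp (l * z.2.2) := Real.one_le_exp (mul_nonneg hl0 hz.1.le)
      have h2 := one_le_barrierProfile z
      rw [barrier, mul_assoc]
      gcongr
      nlinarith
    -- Positivity forces `ε * barrierProfile z < 2 * M`, which bounds both space coordinates by `R`.
    -- Adding 1 keeps `R` positive when `M = 0`, as the initial condition requires.
    set R := 2 * M / ε + 1
    have hR : 0 < R := by positivity
    obtain ⟨δ₁, hδ₁, hd₁⟩ := hi₁ R hR (ε / 2) (half_pos hε)
    obtain ⟨δ₂, hδ₂, hd₂⟩ := hi₂ R hR (ε / 2) (half_pos hε)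
    have hjet := (hv₂.isParabolicJet.sub hv₁.isParabolicJet).sub (isParabolicJet_barrier T ε l)
    have hsupp : ∀ᵐ z : Pt, z ∈ openCyl T → 0 < v₂ z - v₁ z - barrier ε l z →
        |z.1| ≤ R ∧ |z.2.1| ≤ R ∧ min δ₁ δ₂ ≤ z.2.2 := by
      filter_upwards [hrestr hM₁, hrestr hM₂, hrestr hd₁, hrestr hd₂] with z b₁ b₂ i₁ i₂ hz hU
      have h1 := hbar z hz
      have h2 : barrierProfile z ≤ R := by
        have hb₁ := abs_le.1 (b₁ hz)
        have hb₂ := abs_le.1 (b₂ hz)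
        have : barrierProfile z ≤ 2 * M / ε := by
          rw [le_div_iff₀ hε]; linarith
        linarith
      have hy := (abs_snd_le_barrierProfile z).trans h2
      refine ⟨(abs_fst_le_barrierProfile z).trans h2, hy, ?_⟩
      -- At smaller times both functions are within `ε / 2` of the same Gaussian value, so `v₂ - v₁
      -- ≤ ε`, and the barrier is at least `ε`.
      by_contra! ht
      rw [lt_min_iff] at ht
      have k₁ := abs_le.1 (i₁ hz hy ht.1)
      have k₂ := abs_le.1 (i₂ hz hy ht.2)
      have := mul_le_mul_of_nonneg_left (one_le_barrierProfile z) hε.le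
      linarith
    refine hjet.ae_nonpos (a₁ := ν ^ 2 / 2) (a₂ := σ ^ 2 / 2) (c := μ + σ ^ 2 / 2) (c₀ := μ - r)
      (B := M / m * Real.exp R) ha₁ ha₂ (lt_min hδ₁ hδ₂) hsupp ?_
    filter_upwards [hrestr hM₁, hrestr hM₂, hrestr hF, hrestr hmon, hsupp]
      with z b₁ b₂ f d s hz hU
    obtain ⟨-, hy, -⟩ := s hz hU
    have h0 : 0 < barrier ε l z :=
      lt_of_lt_of_le (mul_pos hε (zero_lt_one.trans_le (one_le_barrierProfile z))) (hbar z hz)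
    have hq : 0 ≤ Real.exp z.2.1 / m := by positivity
    have hpt := sub_le_of_max_le_max hq (f hz) (d hz) ((b₁ hz).trans hMM₁) ((b₂ hz).trans hMM₂)
      (by linarith)
    have hsuper := barrier_supersolution (z := z) ha₁.le ha₂.le hc.le hκ hε.le hl
    set ψx := ε * Real.exp (l * z.2.2) * (2 * z.1)
    set dx := weakDeriv T ex v₂ z - weakDeriv T ex v₁ z
    have hqM : Real.exp z.2.1 / m * M = M / m * Real.exp z.2.1 := by ring
    -- The drift is split: the part acting on the barrier keeps its true weight `e^y` and is
    -- absorbed by `hsuper`; the part acting on the difference is bounded by the constant weight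
    -- `e^R`, which suffices on the positivity set.
    have hdx : M / m * Real.exp z.2.1 * |dx| ≤
        M / m * Real.exp R * |dx - ψx| + M / m * Real.exp z.2.1 * |ψx| := by
      have h1 : |dx| ≤ |dx - ψx| + |ψx| := by
        simpa using abs_add_le (dx - ψx) ψx
      have h2 : Real.exp z.2.1 ≤ Real.exp R := Real.exp_le_exp.2 ((le_abs_self _).trans hy)
      calc M / m * Real.exp z.2.1 * |dx|
          ≤ M / m * Real.exp z.2.1 * (|dx - ψx| + |ψx|) := by gcongr
        _ = M / m * Real.exp z.2.1 * |dx - ψx| + M / m * Real.exp z.2.1 * |ψx| := by ring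
        _ ≤ _ := by gcongr
    rw [hqM] at hpt
    simp only [opL] at hpt
    linarith
  have hall := ae_all_iff.2 fun n : ℕ => main (1 / ((n : ℝ) + 1)) (by positivity)
  filter_upwards [hall] with z hz hzT
  have hlim : Tendsto (fun n : ℕ => barrier (1 / ((n : ℝ) + 1)) l z) atTop (𝓝 0) := by
    have := (tendsto_one_div_add_atTop_nhds_zero_nat (𝕜 := ℝ)).mul_const
      (Real.exp (l * z.2.2) * barrierProfile z)
    simpa [barrier, mul_assoc] using this
  exact sub_nonpos.1 (ge_of_tendsto' hlim fun n => by linarith [hz n hzT])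

/-! ### From almost everywhere to every point -/

theorem cyl_subset_closure_openCyl (T : ℝ) : cyl T ⊆ closure (openCyl T) := by
  rintro ⟨x, y, t⟩ ⟨h0, h1⟩
  simp only at h0 h1
  have ht : t ∈ closure (Ioo 0 T) := by
    rw [closure_Ioo (h0.trans_le h1).ne]; exact ⟨h0.le, h1⟩
  have hmap : MapsTo (fun s : ℝ => ((x, y, s) : Pt)) (Ioo 0 T) (openCyl T) := fun s hs => hs
  exact hmap.closure (by fun_prop) ht

end EmissionQuota

/-- Comparison principle. Elements of the Sobolev class are given up to null sets; the conclusion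
holds at every point of `Q` for their continuous representatives, whose existence is part of it. -/
theorem mainTheorem4 (T σ ν μ r m : ℝ) (hT : 0 < T) (hσ : 0 < σ) (hν : 0 < ν) (hμ : 0 < μ)
    (hr : 0 < r) (hm : 0 < m) (hμr : r < μ) (v₁ v₂ : Pt → ℝ)
    (hv₁ : MemSolutionSpace T v₁) (hv₂ : MemSolutionSpace T v₂)
    (hi₁ : GaussianInitial T ν v₁) (hi₂ : GaussianInitial T ν v₂)
    (hF : ∀ᵐ z ∂(volume.restrict (cyl T)),
      opF T σ ν μ r m v₂ z ≤ opF T σ ν μ r m v₁ z)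
    (hmon : ∀ᵐ z ∂(volume.restrict (cyl T)),
      0 ≤ max (weakDeriv T ex v₁ z) (weakDeriv T ex v₂ z)) :
    ∃ w₁ w₂ : Pt → ℝ, ContinuousOn w₁ (cyl T) ∧ ContinuousOn w₂ (cyl T) ∧
      v₁ =ᵐ[volume.restrict (cyl T)] w₁ ∧ v₂ =ᵐ[volume.restrict (cyl T)] w₂ ∧
      ∀ z ∈ cyl T, w₂ z ≤ w₁ z := by
  obtain ⟨w₁, hw₁, he₁⟩ := hv₁.exists_continuousOn hT
  obtain ⟨w₂, hw₂, he₂⟩ := hv₂.exists_continuousOn hT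
  refine ⟨w₁, w₂, hw₁, hw₂, he₁, he₂, ?_⟩
  have hsub := openCyl_subset_cyl T
  have hmax : ContinuousOn (fun z => max (w₁ z) (w₂ z)) (cyl T) := hw₁.sup hw₂
  -- Encoding `w₂ ≤ w₁` as the equality `max w₁ w₂ = w₁` of continuous functions lets it pass from
  -- almost every to every point of the open cylinder, and then by closure to `t = T`.
  have hopen : EqOn (fun z => max (w₁ z) (w₂ z)) w₁ (openCyl T) := by
    refine Measure.eqOn_of_ae_eq (μ := (volume : Measure Pt)) ?_ (hmax.mono hsub) (hw₁.mono hsub)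
      (by rw [(isOpen_openCyl T).interior_eq]; exact subset_closure)
    filter_upwards [ae_restrict_of_ae_restrict_of_subset hsub he₁,
      ae_restrict_of_ae_restrict_of_subset hsub he₂,
      (ae_restrict_iff' (isOpen_openCyl T).measurableSet).2
        (ae_le_of_opF_le hσ hν hμ hm hμr hv₁ hv₂ hi₁ hi₂ hF hmon)] with z h1 h2 h3
    rw [← h1, ← h2, max_eq_left h3]
  have hcyl := hopen.of_subset_closure hmax hw₁ hsub (cyl_subset_closure_openCyl T)
  exact fun z hz => max_eq_left_iff.1 (hcyl hz)
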